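/- Let $K$ be a field, let $\mathcal{C},\mathcal{D},\mathcal{E}$ be small $K$-categories, and let $\mathcal{A}$ be an abelian $K$-category with arbitrary (small) coproducts in which coproducts are exact (AB4). Write $\mathrm{Fun}_K(\mathcal{X},\mathcal{A})$ for the category of $K$-linear functors, $\mathrm{Mod}(\mathcal{X})=\mathrm{Fun}_K(\mathcal{X},\mathrm{Mod}(K))$, and $\mathcal{X}\otimes_K\mathcal{Y}$ for the $K$-category with objects the pairs $(X,Y)$ and morphism spaces $\mathcal{X}(X,X')\otimes_K\mathcal{Y}(Y,Y')$. For an abelian $K$-category $\mathcal{B}$ with coproducts and $F\in\mathrm{Fun}_K(\mathcal{X},\mathcal{B})$, let $F\otimes_{\mathcal{X}}-:\mathrm{Mod}(\mathcal{X}^{op})\to\mathcal{B}$ be the tensor product functor, characterized by $\mathrm{Hom}_{\mathcal{B}}(F\otimes_{\mathcal{X}}G,B)\cong\mathrm{Hom}_{\mathrm{Mod}(\mathcal{X}^{op})}(G,\mathrm{Hom}_{\mathcal{B}}(F(-),B))$ naturally in $B$ and $G$, and let $\mathrm{Tor}^{\mathcal{X}}_n(F,-):\mathrm{Mod}(\mathcal{X}^{op})\to\mathcal{B}$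 be its $n$-th left derived functor. For $G\in\mathrm{Mod}(\mathcal{X}^{op}\otimes_K\mathcal{Y})$ let $F\boxtimes_{\mathcal{X}}G\in\mathrm{Fun}_K(\mathcal{Y},\mathcal{B})$ be the functor $Y\mapsto F\otimes_{\mathcal{X}}G(-,Y)$. Let $F\in\mathrm{Fun}_K(\mathcal{E}^{op}\otimes_K\mathcal{C},\mathcal{A})$, $G\in\mathrm{Mod}(\mathcal{C}^{op}\otimes_K\mathcal{D})$ and $H\in\mathrm{Mod}(\mathcal{D}^{op}\otimes_K\mathcal{E})$. Regard $F$ also as a functor $\mathcal{C}\to\mathrm{Fun}_K(\mathcal{E}^{op},\mathcal{A})$ and $G$ also as a functor $\mathcal{D}\to\mathrm{Mod}(\mathcal{C}^{op})$, and suppose that $$\mathrm{Tor}_n^{\mathcal{C}}(F,G(-,D))=0\ \text{ in } \mathrm{Fun}_K(\mathcal{E}^{op},\mathcal{A})\quad\text{for all } D\in\mathcal{D},\ n>0,$$ $$\mathrm{Tor}_n^{\mathcal{D}}(G,H(-,E))=0\ \text{ in } \mathrm{Mod}(\mathcal{C}^{op})\quad\text{for all } E\in\mathcal{E},\ n>0.$$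 Then, regarding $F\boxtimes_{\mathcal{C}}G:\mathcal{D}\to\mathrm{Fun}_K(\mathcal{E}^{op},\mathcal{A})$ as an object of $\mathrm{Fun}_K(\mathcal{D}\otimes_K\mathcal{E}^{op},\mathcal{A})$ and $G\boxtimes_{\mathcal{D}}H:\mathcal{E}\to\mathrm{Mod}(\mathcal{C}^{op})$ as an object of $\mathrm{Mod}(\mathcal{C}^{op}\otimes_K\mathcal{E})$, for every $i\ge 0$ there is an isomorphism in $\mathcal{A}$ $$\mathrm{Tor}_i^{\mathcal{D}\otimes_K\mathcal{E}^{op}}(F\boxtimes_{\mathcal{C}}G,H)\cong\mathrm{Tor}_i^{\mathcal{E}^{op}\otimes_K\mathcal{C}}(F,G\boxtimes_{\mathcal{D}}H),$$ where $(\mathcal{D}\otimes_K\mathcal{E}^{op})^{op}$ is identified with $\mathcal{D}^{op}\otimes_K\mathcal{E}$ and $(\mathcal{E}^{op}\otimes_K\mathcal{C})^{op}$ with $\mathcal{C}^{op}\otimes_K\mathcal{E}$. -/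

import Mathlib

open CategoryTheory CategoryTheory.Limits Opposite
open scoped TensorProduct

universe w v u

namespace KCat

/-! ## Opposite and tensor product of `K`-categories

A `K`-category is a category with `[Preadditive C] [Linear K C]`: the morphism sets are
`K`-vector spaces and the composition is `K`-bilinear. -/

section Opposites

variable {K : Type u} [Field K] {C : Type w} [Category.{v} C] [Preadditive C] [Linear K C]

/-- The opposite of a `K`-category is a `K`-category. -/
instance linearOpposite : Linear K Cᵒᵖ where
  homModule X Y := Equiv.module K (opEquiv X Y)
  smul_comp _ _ _ r f g := Quiver.Hom.unop_inj (Linear.comp_smul _ _ _ g.unop r f.unop)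
  comp_smul _ _ _ f r g := Quiver.Hom.unop_inj (Linear.smul_comp _ _ _ r g.unop f.unop)

theorem unop_smul {X Y : Cᵒᵖ} (r : K) (f : X ⟶ Y) : (r • f).unop = r • f.unop := rfl

theorem op_smul {X Y : C} (r : K) (f : X ⟶ Y) : (r • f).op = r • f.op := rfl

/-- `f ↦ f.op` as a `K`-linear map. -/
def opLin (X Y : C) : (X ⟶ Y) →ₗ[K] (op Y ⟶ op X) where
  toFun f := f.op
  map_add' _ _ := rfl
  map_smul' _ _ := rfl

/-- `f ↦ f.unop` as a `K`-linear map. -/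
def unopLin (X Y : Cᵒᵖ) : (X ⟶ Y) →ₗ[K] (Y.unop ⟶ X.unop) where
  toFun f := f.unop
  map_add' _ _ := rfl
  map_smul' _ _ := rfl

end Opposites

/-- The objects of the tensor product `C ⊗_K D` of two `K`-categories: those of `C × D`. -/
@[ext]
structure Tens (K : Type u) (C D : Type u) where
  /-- the object of the first factor -/
  fst : C
  /-- the object of the second factor -/
  snd : D

section Tensor

variable (K : Type u) [Field K]
  {C : Type u} [Category.{u} C] [Preadditive C] [Linear K C]
  {D : Type u} [Category.{u} D] [Preadditive D] [Linear K D]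

/-- The composition of `C ⊗_K D`, as a bilinear map. -/
noncomputable def tensComp (X Y Z : Tens K C D) :
    ((X.fst ⟶ Y.fst) ⊗[K] (X.snd ⟶ Y.snd)) →ₗ[K]
      ((Y.fst ⟶ Z.fst) ⊗[K] (Y.snd ⟶ Z.snd)) →ₗ[K]
        ((X.fst ⟶ Z.fst) ⊗[K] (X.snd ⟶ Z.snd)) :=
  TensorProduct.map₂ (Linear.comp X.fst Y.fst Z.fst) (Linear.comp X.snd Y.snd Z.snd)

@[simp]
theorem tensComp_tmul {X Y Z : Tens K C D} (f : X.fst ⟶ Y.fst) (g : X.snd ⟶ Y.snd)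
    (f' : Y.fst ⟶ Z.fst) (g' : Y.snd ⟶ Z.snd) :
    tensComp K X Y Z (f ⊗ₜ g) (f' ⊗ₜ g') = (f ≫ f') ⊗ₜ (g ≫ g') := rfl

/-- The category `C ⊗_K D`: morphisms are `C(c, c') ⊗_K D(d, d')`, with
`(f₁ ⊗ g₁) ≫ (f₂ ⊗ g₂) = (f₁ ≫ f₂) ⊗ (g₁ ≫ g₂)`. -/
noncomputable instance tensCategory : Category.{u} (Tens K C D) where
  Hom X Y := (X.fst ⟶ Y.fst) ⊗[K] (X.snd ⟶ Y.snd)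
  id X := 𝟙 X.fst ⊗ₜ 𝟙 X.snd
  comp {X Y Z} a b := tensComp K X Y Z a b
  id_comp {X Y} a := by
    induction a using TensorProduct.induction_on with
    | zero => simp
    | tmul f g => simp
    | add a b ha hb => rw [map_add, ha, hb]
  comp_id {X Y} a := by
    induction a using TensorProduct.induction_on with
    | zero => simp
    | tmul f g => simp
    | add a b ha hb => rw [map_add, LinearMap.add_apply, ha, hb]
  assoc {W X Y Z} a b c := by
    induction a using TensorProduct.induction_on with
    | zero => simp
    | add a a' ha ha' => simp only [map_add, LinearMap.add_apply, ha, ha']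
    | tmul f g =>
      induction b using TensorProduct.induction_on with
      | zero => simp
      | add b b' hb hb' => simp only [map_add, LinearMap.add_apply, hb, hb']
      | tmul f' g' =>
        induction c using TensorProduct.induction_on with
        | zero => simp
        | add c c' hc hc' => simp only [map_add, hc, hc']
        | tmul f'' g'' => simp

noncomputable instance tensPreadditive : Preadditive (Tens K C D) where
  homGroup X Y := inferInstanceAs (AddCommGroup ((X.fst ⟶ Y.fst) ⊗[K] (X.snd ⟶ Y.snd)))
  add_comp X Y Z a a' b := LinearMap.map_add₂ (tensComp K X Y Z) a a' b
  comp_add X Y Z a b b' := LinearMap.map_add (tensComp K X Y Z a) b b'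

noncomputable instance tensLinear : Linear K (Tens K C D) where
  homModule X Y := inferInstanceAs (Module K ((X.fst ⟶ Y.fst) ⊗[K] (X.snd ⟶ Y.snd)))
  smul_comp X Y Z r a b := LinearMap.map_smul₂ (tensComp K X Y Z) r a b
  comp_smul X Y Z a r b := LinearMap.map_smul (tensComp K X Y Z a) r b

/-- The pure tensor `f ⊗ g` as a morphism of `C ⊗_K D`. -/
noncomputable def tensHom {X Y : Tens K C D} (f : X.fst ⟶ Y.fst) (g : X.snd ⟶ Y.snd) : X ⟶ Y :=
  (f ⊗ₜ[K] g : (X.fst ⟶ Y.fst) ⊗[K] (X.snd ⟶ Y.snd))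

theorem tensHom_comp {X Y Z : Tens K C D} (f : X.fst ⟶ Y.fst) (g : X.snd ⟶ Y.snd)
    (f' : Y.fst ⟶ Z.fst) (g' : Y.snd ⟶ Z.snd) :
    tensHom K f g ≫ tensHom K f' g' = tensHom K (f ≫ f') (g ≫ g') := rfl

theorem tensHom_id (X : Tens K C D) : tensHom K (𝟙 X.fst) (𝟙 X.snd) = 𝟙 X := rfl

theorem tensHom_add_left {X Y : Tens K C D} (f f' : X.fst ⟶ Y.fst) (g : X.snd ⟶ Y.snd) :
    tensHom K (f + f') g = tensHom K f g + tensHom K f' g := TensorProduct.add_tmul _ _ _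

theorem tensHom_add_right {X Y : Tens K C D} (f : X.fst ⟶ Y.fst) (g g' : X.snd ⟶ Y.snd) :
    tensHom K f (g + g') = tensHom K f g + tensHom K f g' := TensorProduct.tmul_add _ _ _

theorem tensHom_smul_left {X Y : Tens K C D} (r : K) (f : X.fst ⟶ Y.fst) (g : X.snd ⟶ Y.snd) :
    tensHom K (r • f) g = r • tensHom K f g := rfl

theorem tensHom_smul_right {X Y : Tens K C D} (r : K) (f : X.fst ⟶ Y.fst) (g : X.snd ⟶ Y.snd) :
    tensHom K f (r • g) = r • tensHom K f g := TensorProduct.tmul_smul _ _ _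

/-- Morphisms of `C ⊗_K D` are sums of pure tensors. -/
theorem tensHom_induction {X Y : Tens K C D} {p : (X ⟶ Y) → Prop} (a : X ⟶ Y) (zero : p 0)
    (tmul : ∀ f g, p (tensHom K f g)) (add : ∀ a b, p a → p b → p (a + b)) : p a :=
  TensorProduct.induction_on
    (motive := fun z : (X.fst ⟶ Y.fst) ⊗[K] (X.snd ⟶ Y.snd) => p z) a zero tmul add

end Tensor

/-! ## Categories of `K`-linear functors -/

section LinFun

variable (K : Type u) [Field K]

/-- The property of being a `K`-functor: `K`-linear on morphism spaces. -/
def isLin {C : Type*} [Category* C] [Preadditive C] [Linear K C]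
    {A : Type*} [Category* A] [Preadditive A] [Linear K A] : ObjectProperty (C ⥤ A) :=
  fun F => F.Additive ∧ F.Linear K

/-- `Fun_K(C, A)`: the category of `K`-functors and all natural transformations. -/
abbrev LinFun (C : Type*) [Category* C] [Preadditive C] [Linear K C]
    (A : Type*) [Category* A] [Preadditive A] [Linear K A] :=
  (isLin K (C := C) (A := A)).FullSubcategory

variable {K}

section Closure

variable {C : Type*} [Category* C] [Preadditive C] [Linear K C]
  {A : Type*} [Category* A] [Preadditive A] [Linear K A]

instance (F : LinFun K C A) : F.obj.Additive := F.property.1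

instance (F : LinFun K C A) : F.obj.Linear K := F.property.2

theorem isLin_of_isColimit {J : Type*} [Category* J] {D : J ⥤ C ⥤ A} {c : Cocone D}
    (hc : ∀ X, IsColimit (((evaluation C A).obj X).mapCocone c))
    (h : ∀ j, isLin K (D.obj j)) : isLin K c.pt := by
  have nat : ∀ (j : J) {X Y : C} (k : X ⟶ Y),
      (D.obj j).map k ≫ (c.ι.app j).app Y = (c.ι.app j).app X ≫ c.pt.map k :=
    fun j _ _ k => (c.ι.app j).naturality k
  refine ⟨⟨fun {X Y f g} => (hc X).hom_ext fun j => ?_⟩,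
    ⟨fun {X Y} f r => (hc X).hom_ext fun j => ?_⟩⟩
  · have := (h j).1
    change (c.ι.app j).app X ≫ c.pt.map (f + g) =
      (c.ι.app j).app X ≫ (c.pt.map f + c.pt.map g)
    rw [← nat, Functor.map_add, Preadditive.add_comp, Preadditive.comp_add,
      nat, nat]
  · have := (h j).2
    change (c.ι.app j).app X ≫ c.pt.map (r • f) = (c.ι.app j).app X ≫ (r • c.pt.map f)
    rw [← nat, Functor.map_smul, Linear.smul_comp, Linear.comp_smul,
      nat]

theorem isLin_of_isLimit {J : Type*} [Category* J] {D : J ⥤ C ⥤ A} {c : Cone D}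
    (hc : ∀ X, IsLimit (((evaluation C A).obj X).mapCone c))
    (h : ∀ j, isLin K (D.obj j)) : isLin K c.pt := by
  have nat : ∀ (j : J) {X Y : C} (k : X ⟶ Y),
      c.pt.map k ≫ (c.π.app j).app Y = (c.π.app j).app X ≫ (D.obj j).map k :=
    fun j _ _ k => (c.π.app j).naturality k
  refine ⟨⟨fun {X Y f g} => (hc Y).hom_ext fun j => ?_⟩,
    ⟨fun {X Y} f r => (hc Y).hom_ext fun j => ?_⟩⟩
  · have := (h j).1
    change c.pt.map (f + g) ≫ (c.π.app j).app Y =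
      (c.pt.map f + c.pt.map g) ≫ (c.π.app j).app Y
    rw [nat, Functor.map_add, Preadditive.add_comp, Preadditive.comp_add,
      nat, nat]
  · have := (h j).2
    change c.pt.map (r • f) ≫ (c.π.app j).app Y = (r • c.pt.map f) ≫ (c.π.app j).app Y
    rw [nat, Functor.map_smul, Linear.smul_comp, Linear.comp_smul,
      nat]

instance isLin_closedUnderColimits (J : Type*) [Category* J] [HasColimitsOfShape J A] :
    (isLin K (C := C) (A := A)).IsClosedUnderColimitsOfShape J where
  colimitsOfShape_le := by
    rintro F ⟨p⟩
    exact isLin_of_isColimit (fun X => isColimitOfPreserves ((evaluation C A).obj X) p.isColimit)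
      p.prop_diag_obj

instance isLin_closedUnderLimits (J : Type*) [Category* J] [HasLimitsOfShape J A] :
    (isLin K (C := C) (A := A)).IsClosedUnderLimitsOfShape J where
  limitsOfShape_le := by
    rintro F ⟨p⟩
    exact isLin_of_isLimit (fun X => isLimitOfPreserves ((evaluation C A).obj X) p.isLimit)
      p.prop_diag_obj

end Closure

section Abelian

variable {C : Type*} [Category* C] [Preadditive C] [Linear K C]
  {A : Type*} [Category* A] [Abelian A] [Linear K A]

instance : (isLin K (C := C) (A := A)).IsClosedUnderCokernels where
  cokernels_le := by
    rintro _ ⟨f, k, hk, h₁, h₂⟩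
    refine (isLin K (C := C) (A := A)).prop_of_isColimit hk ?_
    rintro (_ | _)
    exacts [h₁, h₂]

instance : (isLin K (C := C) (A := A)).IsClosedUnderKernels where
  kernels_le := by
    rintro _ ⟨f, k, hk, h₁, h₂⟩
    refine (isLin K (C := C) (A := A)).prop_of_isLimit hk ?_
    rintro (_ | _)
    exacts [h₁, h₂]

instance : (isLin K (C := C) (A := A)).IsClosedUnderFiniteProducts where
  isClosedUnderLimitsOfShape J _ := by
    have : HasLimitsOfShape (Discrete J) A := inferInstance
    infer_instance

instance : (isLin K (C := C) (A := A)).ContainsZero where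
  exists_zero := by
    obtain ⟨Z, hZ⟩ := (inferInstance : HasZeroObject A).zero
    refine ⟨(Functor.const C).obj Z, ?_, ⟨⟨?_⟩, ⟨?_⟩⟩⟩
    · rw [Functor.isZero_iff]
      exact fun _ => hZ
    · intros; exact (hZ).eq_of_src _ _
    · intros; exact (hZ).eq_of_src _ _

end Abelian

section Projectives

variable {C : Type u} [Category.{u} C] [Preadditive C] [Linear K C]

/-- `Mod(C) = Fun_K(C, Mod(K))`. -/
abbrev LinMod (K : Type u) [Field K] (C : Type u) [Category.{u} C] [Preadditive C] [Linear K C] :=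
  LinFun K C (ModuleCat.{u} K)

variable (K) in
/-- The representable functor `C(X, -)` in `Mod(C)`. -/
def rep (X : C) : LinMod K C :=
  ⟨(linearCoyoneda K C).obj (op X), inferInstance,
    ⟨fun f r => by ext g; exact Linear.comp_smul _ _ _ g r f⟩⟩

/-- The Yoneda morphism `C(X, -) ⟶ G` attached to an element of `G(X)`. -/
def repDesc (G : LinMod K C) {X : C} (x : G.obj.obj X) : rep K X ⟶ G :=
  ObjectProperty.homMk
    { app := fun Y => ModuleCat.ofHom
        { toFun := fun (f : X ⟶ Y) => (G.obj.map f).hom x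
          map_add' := fun f g => by simp [Functor.map_add]
          map_smul' := fun r f => by simp [Functor.map_smul] }
      naturality := fun Y Z g => by
        ext (f : X ⟶ Y)
        exact congr($(G.obj.map_comp f g).hom x) }

theorem repDesc_id (G : LinMod K C) {X : C} (x : G.obj.obj X) :
    ((repDesc G x).hom.app X).hom (𝟙 X : X ⟶ X) = x :=
  congr($(G.obj.map_id X).hom x)

theorem rep_hom_ext {G : LinMod K C} {X : C} {f g : rep K X ⟶ G}
    (h : (f.hom.app X).hom (𝟙 X : X ⟶ X) = (g.hom.app X).hom (𝟙 X : X ⟶ X)) : f = g := by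
  ext Y (k : X ⟶ Y)
  have key : ∀ (f : rep K X ⟶ G),
      (f.hom.app Y).hom k = (G.obj.map k).hom ((f.hom.app X).hom (𝟙 X : X ⟶ X)) := by
    intro f
    have := congr($(f.hom.naturality k).hom (𝟙 X : X ⟶ X))
    refine Eq.trans ?_ this
    exact congrArg (f.hom.app Y).hom (Category.id_comp k).symm
  exact (key f).trans ((congrArg _ h).trans (key g).symm)

instance rep_projective (X : C) : Projective (rep K X) where
  factors {E G} f e _ := by
    have h₁ : Epi e.hom :=
      have := (isLin K (C := C)
        (A := ModuleCat.{u} K)).preservesEpimorphisms_ι_of_isNormalMonoCategory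
      inferInstanceAs (Epi ((isLin K (C := C) (A := ModuleCat.{u} K)).ι.map e))
    have h₂ : Epi (e.hom.app X) := inferInstance
    obtain ⟨y, hy⟩ := (ModuleCat.epi_iff_surjective _).1 h₂ ((f.hom.app X).hom (𝟙 X : X ⟶ X))
    refine ⟨repDesc E y, rep_hom_ext ?_⟩
    refine Eq.trans ?_ hy
    exact congrArg (e.hom.app X).hom (repDesc_id E y)

/-- `Mod(C)` has enough projectives: coproducts of representables. -/
instance linMod_enoughProjectives : EnoughProjectives (LinMod K C) where
  presentation G := ⟨
    { p := ∐ fun p : (Σ X : C, G.obj.obj X) => rep K p.1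
      f := Sigma.desc fun p => repDesc G p.2
      epi := ⟨fun {Z} f g h => by
        ext X x
        have h' : repDesc G x ≫ f = repDesc G x ≫ g := by
          have := congr(Sigma.ι (fun p : (Σ X : C, G.obj.obj X) => rep K p.1) ⟨X, x⟩ ≫ $h)
          simpa using this
        have := congr(($(h').hom.app X).hom (𝟙 X : X ⟶ X))
        refine Eq.trans ?_ (this.trans ?_)
        · exact congrArg (f.hom.app X).hom (repDesc_id G x).symm
        · exact congrArg (g.hom.app X).hom (repDesc_id G x)⟩ }⟩

end Projectives

end LinFun

/-! ## The tensor product `F ⊗_C G` of `F : C → A` and `G : Cᵒᵖ → Mod(K)`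

It is given by generators and relations, and represents `X ↦ Hom_{Mod(Cᵒᵖ)}(G, Hom_A(F, X))`:
a morphism `F ⊗_C G ⟶ X` is a family of morphisms `φ_{c,x} : F(c) ⟶ X` for `c ∈ C`, `x ∈ G(c)`,
that is `K`-linear in `x` and satisfies `φ_{c, G(f)x} = φ_{c',x} ∘ F(f)` for `f : c ⟶ c'` and
`x ∈ G(c')`. -/

section TensorProduct

variable {K : Type u} [Field K] {C : Type u} [Category.{u} C] [Preadditive C] [Linear K C]
  {A : Type w} [Category.{v} A] [Abelian A] [Linear K A] [HasCoproducts.{u} A]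

/-- The elements of `G`: they index the generators of `F ⊗_C G`. -/
abbrev TensGen (G : LinMod K Cᵒᵖ) : Type u := Σ c : C, G.obj.obj (op c)

/-- The relations of `F ⊗_C G` that live at the object `c`. -/
inductive TensRel (G : LinMod K Cᵒᵖ) (c : C) : Type u
  | add (x y : G.obj.obj (op c))
  | smul (r : K) (x : G.obj.obj (op c))
  | nat (c' : C) (f : c ⟶ c') (x : G.obj.obj (op c'))

variable (F : LinFun K C A) (G : LinMod K Cᵒᵖ)

/-- The inclusion of the generator `(c, x)` into the coproduct of the `F(c)` over all `(c, x)`. -/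
noncomputable abbrev genι (c : C) (x : G.obj.obj (op c)) :
    F.obj.obj c ⟶ ∐ fun p : TensGen G => F.obj.obj p.1 :=
  Sigma.ι (fun p : TensGen G => F.obj.obj p.1) ⟨c, x⟩

/-- The expression that a relation forces to vanish. -/
noncomputable def relMap (c : C) : TensRel G c →
    (F.obj.obj c ⟶ ∐ fun p : TensGen G => F.obj.obj p.1)
  | .add x y => genι F G c (x + y) - (genι F G c x + genι F G c y)
  | .smul r x => genι F G c (r • x) - r • genι F G c x
  | .nat c' f x => genι F G c ((G.obj.map f.op).hom x) - F.obj.map f ≫ genι F G c' x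

/-- All the relations together, as a morphism between coproducts. -/
noncomputable def relAll :
    (∐ fun ρ : (Σ c : C, TensRel G c) => F.obj.obj ρ.1) ⟶
      ∐ fun p : TensGen G => F.obj.obj p.1 :=
  Sigma.desc fun ρ => relMap F G ρ.1 ρ.2

/-- The object `F ⊗_C G` of `A`. -/
noncomputable def tensObj : A := cokernel (relAll F G)

/-- The projection of the coproduct of the generators onto `F ⊗_C G`. -/
noncomputable def tensπ : (∐ fun p : TensGen G => F.obj.obj p.1) ⟶ tensObj F G :=
  cokernel.π (relAll F G)

instance : Epi (tensπ F G) := inferInstanceAs (Epi (cokernel.π (relAll F G)))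

variable {G}

/-- The canonical morphism `F(c) ⟶ F ⊗_C G` attached to `x ∈ G(c)`. -/
noncomputable def tensι {c : C} (x : G.obj.obj (op c)) : F.obj.obj c ⟶ tensObj F G :=
  genι F G c x ≫ tensπ F G

theorem relMap_π (c : C) (ρ : TensRel G c) : relMap F G c ρ ≫ tensπ F G = 0 := by
  have h : Sigma.ι (fun ρ : (Σ c : C, TensRel G c) => F.obj.obj ρ.1) ⟨c, ρ⟩ ≫ relAll F G =
      relMap F G c ρ := Sigma.ι_desc _ _
  rw [← h, Category.assoc, show relAll F G ≫ tensπ F G = 0 from cokernel.condition _, comp_zero]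

theorem tensι_add {c : C} (x y : G.obj.obj (op c)) :
    tensι F (x + y) = tensι F x + tensι F y := by
  have := relMap_π F c (.add x y)
  rwa [relMap, Preadditive.sub_comp, sub_eq_zero, Preadditive.add_comp] at this

theorem tensι_smul {c : C} (r : K) (x : G.obj.obj (op c)) :
    tensι F (r • x) = r • tensι F x := by
  have := relMap_π F c (.smul r x)
  rwa [relMap, Preadditive.sub_comp, sub_eq_zero, Linear.smul_comp] at this

theorem tensι_nat {c c' : C} (f : c ⟶ c') (x : G.obj.obj (op c')) :
    tensι F ((G.obj.map f.op).hom x) = F.obj.map f ≫ tensι F x := by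
  have := relMap_π F c (.nat c' f x)
  rwa [relMap, Preadditive.sub_comp, sub_eq_zero, Category.assoc] at this

variable {F}

theorem tens_hom_ext {X : A} {f g : tensObj F G ⟶ X}
    (h : ∀ (c : C) (x : G.obj.obj (op c)), tensι F x ≫ f = tensι F x ≫ g) : f = g := by
  have key : tensπ F G ≫ f = tensπ F G ≫ g :=
    Sigma.hom_ext _ _ fun p => by
      have := h p.1 p.2
      rw [tensι, Category.assoc, Category.assoc] at this
      exact this
  exact (cancel_epi (tensπ F G)).1 key

/-- The universal property of `F ⊗_C G`. -/
noncomputable def tensDesc {X : A} (φ : ∀ c : C, G.obj.obj (op c) → (F.obj.obj c ⟶ X))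
    (hadd : ∀ c x y, φ c (x + y) = φ c x + φ c y)
    (hsmul : ∀ c (r : K) x, φ c (r • x) = r • φ c x)
    (hnat : ∀ (c c' : C) (f : c ⟶ c') (x : G.obj.obj (op c')),
      φ c ((G.obj.map f.op).hom x) = F.obj.map f ≫ φ c' x) : tensObj F G ⟶ X :=
  cokernel.desc (relAll F G) (Sigma.desc fun p : TensGen G => φ p.1 p.2) <| by
    have h : ∀ c x, genι F G c x ≫ Sigma.desc (fun p : TensGen G => φ p.1 p.2) = φ c x :=
      fun c x => Sigma.ι_desc _ _
    refine Sigma.hom_ext _ _ fun ρ => ?_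
    rw [relAll, Sigma.ι_desc_assoc, comp_zero]
    rcases ρ with ⟨c, ⟨x, y⟩ | ⟨r, x⟩ | ⟨c', f, x⟩⟩
    · rw [relMap, Preadditive.sub_comp, Preadditive.add_comp, h, h, h, hadd, sub_self]
    · rw [relMap, Preadditive.sub_comp, Linear.smul_comp, h, h, hsmul, sub_self]
    · rw [relMap, Preadditive.sub_comp, Category.assoc, h, h, hnat, sub_self]

theorem tensι_desc {X : A} (φ : ∀ c : C, G.obj.obj (op c) → (F.obj.obj c ⟶ X))
    (hadd : ∀ c x y, φ c (x + y) = φ c x + φ c y)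
    (hsmul : ∀ c (r : K) x, φ c (r • x) = r • φ c x)
    (hnat : ∀ (c c' : C) (f : c ⟶ c') (x : G.obj.obj (op c')),
      φ c ((G.obj.map f.op).hom x) = F.obj.map f ≫ φ c' x) {c : C} (x : G.obj.obj (op c)) :
    tensι F x ≫ tensDesc φ hadd hsmul hnat = φ c x := by
  rw [tensι, Category.assoc]
  refine (congrArg (genι F G c x ≫ ·) (cokernel.π_desc _ _ _)).trans ?_
  exact Sigma.ι_desc _ _

/-- `F ⊗_C α` for `α : G ⟶ G'`. -/
noncomputable def tensMap (F : LinFun K C A) {G G' : LinMod K Cᵒᵖ} (α : G ⟶ G') :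
    tensObj F G ⟶ tensObj F G' :=
  tensDesc (fun c x => tensι F ((α.hom.app (op c)).hom x))
    (fun c x y => by rw [map_add, tensι_add]) (fun c r x => by rw [map_smul, tensι_smul])
    (fun c c' f x => by
      rw [← tensι_nat]
      exact congrArg (tensι F) congr($(α.hom.naturality f.op).hom x))

theorem tensι_map (F : LinFun K C A) {G G' : LinMod K Cᵒᵖ} (α : G ⟶ G') {c : C}
    (x : G.obj.obj (op c)) :
    tensι F x ≫ tensMap F α = tensι F ((α.hom.app (op c)).hom x) := by
  rw [tensMap, tensι_desc]

/-- The functor `F ⊗_C - : Mod(Cᵒᵖ) → A`. -/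
noncomputable def tensFunctor (F : LinFun K C A) : LinMod K Cᵒᵖ ⥤ A where
  obj G := tensObj F G
  map α := tensMap F α
  map_id G := tens_hom_ext fun c x => by
    rw [tensι_map, Category.comp_id]; rfl
  map_comp α β := tens_hom_ext fun c x => by
    rw [tensι_map, ← Category.assoc, tensι_map, tensι_map]; rfl

instance (F : LinFun K C A) : (tensFunctor F).Additive where
  map_add {G G' α β} := tens_hom_ext fun c x => by
    change tensι F x ≫ tensMap F (α + β) = tensι F x ≫ (tensMap F α + tensMap F β)
    rw [Preadditive.comp_add, tensι_map, tensι_map, tensι_map, ← tensι_add]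
    rfl

instance (F : LinFun K C A) : (tensFunctor F).Linear K where
  map_smul {G G'} α r := tens_hom_ext fun c x => by
    change tensι F x ≫ tensMap F (r • α) = tensι F x ≫ (r • tensMap F α)
    rw [Linear.comp_smul, tensι_map, tensι_map, ← tensι_smul]
    rfl

/-- `Tor_n^C(F, G)`, an object of `A`: the `n`-th left derived functor of
`F ⊗_C - : Mod(Cᵒᵖ) → A`, evaluated at `G`. -/
noncomputable def Tor (n : ℕ) (F : LinFun K C A) (G : LinMod K Cᵒᵖ) : A :=
  ((tensFunctor F).leftDerived n).obj G

end TensorProduct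

/-! ## Functors of two variables -/

section TwoVariables

variable {K : Type u} [Field K]
  {X : Type u} [Category.{u} X] [Preadditive X] [Linear K X]
  {Y : Type u} [Category.{u} Y] [Preadditive Y] [Linear K Y]
  {A : Type w} [Category.{v} A] [Preadditive A] [Linear K A]

/-- The functor `L(-, y)`. -/
noncomputable def curryObj (L : LinFun K (Tens K X Y) A) (y : Y) : LinFun K X A where
  obj :=
    { obj := fun x => L.obj.obj ⟨x, y⟩
      map := fun {x x'} f =>
        L.obj.map (tensHom K (X := ⟨x, y⟩) (Y := ⟨x', y⟩) f (𝟙 y))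
      map_id := fun x => L.obj.map_id (⟨x, y⟩ : Tens K X Y)
      map_comp := fun f g => by rw [← L.obj.map_comp, tensHom_comp, Category.comp_id] }
  property := ⟨⟨fun {x x' f g} => by
      change L.obj.map (tensHom K (X := ⟨x, y⟩) (Y := ⟨x', y⟩) (f + g) _) = _
      rw [tensHom_add_left, Functor.map_add]⟩, ⟨fun {x x'} f r => by
      change L.obj.map (tensHom K (X := ⟨x, y⟩) (Y := ⟨x', y⟩) (r • f) _) = _
      rw [tensHom_smul_left, Functor.map_smul]⟩⟩

/-- The morphism `L(-, y) ⟶ L(-, y')` induced by `g : y ⟶ y'`. -/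
noncomputable def curryMap (L : LinFun K (Tens K X Y) A) {y y' : Y} (g : y ⟶ y') :
    curryObj L y ⟶ curryObj L y' :=
  ObjectProperty.homMk
    { app := fun x => L.obj.map (tensHom K (X := ⟨x, y⟩) (Y := ⟨x, y'⟩) (𝟙 x) g)
      naturality := fun x x' f => by
        change L.obj.map _ ≫ L.obj.map _ = L.obj.map _ ≫ L.obj.map _
        rw [← L.obj.map_comp, ← L.obj.map_comp, tensHom_comp, tensHom_comp,
          Category.comp_id, Category.id_comp, Category.comp_id, Category.id_comp] }

theorem curryMap_app (L : LinFun K (Tens K X Y) A) {y y' : Y} (g : y ⟶ y') (x : X) :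
    (curryMap L g).hom.app x =
      L.obj.map (tensHom K (X := ⟨x, y⟩) (Y := ⟨x, y'⟩) (𝟙 x) g) := rfl

theorem linFun_hom_ext {F G : LinFun K X A} {α β : F ⟶ G}
    (h : ∀ x, α.hom.app x = β.hom.app x) : α = β :=
  ObjectProperty.hom_ext _ (NatTrans.ext (funext h))

/-- A functor `L` on `X ⊗_K Y`, seen as the functor `y ↦ L(-, y)` from `Y` to `Fun_K(X, A)`. -/
noncomputable def curry (L : LinFun K (Tens K X Y) A) : LinFun K Y (LinFun K X A) where
  obj :=
    { obj := curryObj L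
      map := curryMap L
      map_id := fun y => linFun_hom_ext fun x => L.obj.map_id (⟨x, y⟩ : Tens K X Y)
      map_comp := fun {y y' y''} f g => linFun_hom_ext fun x => by
        have h : (curryMap L f ≫ curryMap L g).hom.app x =
          (curryMap L f).hom.app x ≫ (curryMap L g).hom.app x := rfl
        rw [h, curryMap_app, curryMap_app, curryMap_app]
        refine Eq.trans ?_ (L.obj.map_comp _ _)
        rw [tensHom_comp, Category.comp_id] }
  property := ⟨⟨fun {y y' f g} => linFun_hom_ext fun x => by
      have h : (curryMap L f + curryMap L g).hom.app x =
        (curryMap L f).hom.app x + (curryMap L g).hom.app x := rfl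
      rw [h, curryMap_app, curryMap_app, curryMap_app, tensHom_add_right]
      exact L.obj.map_add⟩, ⟨fun {y y'} f r => linFun_hom_ext fun x => by
      have h : (r • curryMap L f).hom.app x = r • (curryMap L f).hom.app x := rfl
      rw [h, curryMap_app, curryMap_app, tensHom_smul_right]
      exact L.obj.map_smul _ _⟩⟩

/-- The action of `M : Y → Fun_K(X, A)` on morphisms in both variables:
`g ⊗ f ↦ M(y')(f) ∘ M(g)(x)`. -/
noncomputable def uncurryMap (M : LinFun K Y (LinFun K X A)) (P Q : Tens K Y X) :
    ((P.fst ⟶ Q.fst) ⊗[K] (P.snd ⟶ Q.snd)) →ₗ[K]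
      ((M.obj.obj P.fst).obj.obj P.snd ⟶ (M.obj.obj Q.fst).obj.obj Q.snd) :=
  TensorProduct.lift <| LinearMap.mk₂ K
    (fun g f => (M.obj.map g).hom.app P.snd ≫ (M.obj.obj Q.fst).obj.map f)
    (fun g g' f => by rw [Functor.map_add]; exact Preadditive.add_comp _ _ _ _ _ _)
    (fun r g f => by rw [Functor.map_smul]; exact Linear.smul_comp _ _ _ _ _ _)
    (fun g f f' => by rw [Functor.map_add, Preadditive.comp_add])
    (fun r g f => by rw [Functor.map_smul, Linear.comp_smul])

theorem uncurryMap_tensHom (M : LinFun K Y (LinFun K X A)) {P Q : Tens K Y X}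
    (g : P.fst ⟶ Q.fst) (f : P.snd ⟶ Q.snd) :
    uncurryMap M P Q (tensHom K g f) =
      (M.obj.map g).hom.app P.snd ≫ (M.obj.obj Q.fst).obj.map f :=
  TensorProduct.lift.tmul _ _

/-- A functor `M : Y → Fun_K(X, A)`, seen as a functor on `Y ⊗_K X`. -/
noncomputable def uncurry (M : LinFun K Y (LinFun K X A)) : LinFun K (Tens K Y X) A where
  obj :=
    { obj := fun P => (M.obj.obj P.fst).obj.obj P.snd
      map := fun {P Q} a => uncurryMap M P Q a
      map_id := fun P => by
        rw [← tensHom_id, uncurryMap_tensHom, M.obj.map_id, (M.obj.obj P.fst).obj.map_id]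
        exact Category.comp_id _
      map_comp := fun {P Q R} a b => by
        induction a using tensHom_induction with
        | zero =>
          rw [zero_comp]
          exact (map_zero (uncurryMap M P R)).trans
            ((congrArg (· ≫ _) (map_zero (uncurryMap M P Q))).trans zero_comp).symm
        | add a a' h h' =>
          rw [Preadditive.add_comp]
          refine (map_add (uncurryMap M P R) _ _).trans ?_
          refine Eq.trans ?_ (congrArg (· ≫ _) (map_add (uncurryMap M P Q) a a')).symm
          rw [h, h', ← Preadditive.add_comp]
        | tmul g f =>
          induction b using tensHom_induction with
          | zero =>
            rw [comp_zero]
            exact (map_zero (uncurryMap M P R)).trans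
              ((congrArg (_ ≫ ·) (map_zero (uncurryMap M Q R))).trans comp_zero).symm
          | add b b' h h' =>
            rw [Preadditive.comp_add]
            refine (map_add (uncurryMap M P R) _ _).trans ?_
            refine Eq.trans ?_ (congrArg (_ ≫ ·) (map_add (uncurryMap M Q R) b b')).symm
            rw [h, h', ← Preadditive.comp_add]
          | tmul g' f' =>
            rw [tensHom_comp, uncurryMap_tensHom, uncurryMap_tensHom, uncurryMap_tensHom,
              M.obj.map_comp, (M.obj.obj R.fst).obj.map_comp]
            have h₁ := (M.obj.map g').hom.naturality f
            have h₂ : (M.obj.map g ≫ M.obj.map g').hom.app P.snd =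
              (M.obj.map g).hom.app P.snd ≫ (M.obj.map g').hom.app P.snd := rfl
            rw [h₂, Category.assoc, Category.assoc]
            exact congrArg ((M.obj.map g).hom.app P.snd ≫ ·)
              ((Category.assoc _ _ _).symm.trans
                ((congrArg (· ≫ (M.obj.obj R.fst).obj.map f') h₁.symm).trans
                  (Category.assoc _ _ _))) }
  property := ⟨⟨fun {P Q a b} => map_add (uncurryMap M P Q) a b⟩,
    ⟨fun {P Q} a r => map_smul (uncurryMap M P Q) r a⟩⟩

/-- Restriction of a `K`-functor along a `K`-functor `P`. -/
def precomp (P : X ⥤ Y) [P.Additive] [P.Linear K] (L : LinFun K Y A) : LinFun K X A :=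
  ⟨P ⋙ L.obj, inferInstance, inferInstance⟩

variable (K X Y)

/-- `f ⊗ g.op ↦ f.op ⊗ g`. -/
noncomputable def opTensRightMap {P Q : Tens K X Yᵒᵖ} :
    (P ⟶ Q) →ₗ[K] ((⟨op Q.fst, Q.snd.unop⟩ : Tens K Xᵒᵖ Y) ⟶ ⟨op P.fst, P.snd.unop⟩) :=
  TensorProduct.map (opLin (K := K) P.fst Q.fst) (unopLin (K := K) P.snd Q.snd)

/-- `f.op ⊗ g ↦ f ⊗ g.op`. -/
noncomputable def opTensLeftMap {P Q : Tens K Xᵒᵖ Y} :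
    (P ⟶ Q) →ₗ[K] ((⟨Q.fst.unop, op Q.snd⟩ : Tens K X Yᵒᵖ) ⟶ ⟨P.fst.unop, op P.snd⟩) :=
  TensorProduct.map (unopLin (K := K) P.fst Q.fst) (opLin (K := K) P.snd Q.snd)

/-- The identification of `(X ⊗_K Yᵒᵖ)ᵒᵖ` with `Xᵒᵖ ⊗_K Y`. -/
noncomputable def opTensRight : (Tens K X Yᵒᵖ)ᵒᵖ ⥤ Tens K Xᵒᵖ Y where
  obj P := ⟨op P.unop.fst, P.unop.snd.unop⟩
  map a := opTensRightMap K X Y a.unop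
  map_id P := rfl
  map_comp {P Q R} a b := by
    obtain ⟨b, rfl⟩ : ∃ b' : R.unop ⟶ Q.unop, b'.op = b := ⟨b.unop, rfl⟩
    obtain ⟨a, rfl⟩ : ∃ a' : Q.unop ⟶ P.unop, a'.op = a := ⟨a.unop, rfl⟩
    change opTensRightMap K X Y (b ≫ a) = opTensRightMap K X Y a ≫ opTensRightMap K X Y b
    induction a using tensHom_induction with
    | zero => rw [comp_zero, map_zero, map_zero, zero_comp]
    | add a a' h h' => rw [Preadditive.comp_add, map_add, map_add, h, h', Preadditive.add_comp]
    | tmul f g =>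
      induction b using tensHom_induction with
      | zero => rw [zero_comp, map_zero, map_zero, comp_zero]
      | add b b' h h' =>
        rw [Preadditive.add_comp, map_add, map_add, h, h', Preadditive.comp_add]
      | tmul f' g' => rfl

/-- The identification of `(Xᵒᵖ ⊗_K Y)ᵒᵖ` with `X ⊗_K Yᵒᵖ`. -/
noncomputable def opTensLeft : (Tens K Xᵒᵖ Y)ᵒᵖ ⥤ Tens K X Yᵒᵖ where
  obj P := ⟨P.unop.fst.unop, op P.unop.snd⟩
  map a := opTensLeftMap K X Y a.unop
  map_id P := rfl
  map_comp {P Q R} a b := by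
    obtain ⟨b, rfl⟩ : ∃ b' : R.unop ⟶ Q.unop, b'.op = b := ⟨b.unop, rfl⟩
    obtain ⟨a, rfl⟩ : ∃ a' : Q.unop ⟶ P.unop, a'.op = a := ⟨a.unop, rfl⟩
    change opTensLeftMap K X Y (b ≫ a) = opTensLeftMap K X Y a ≫ opTensLeftMap K X Y b
    induction a using tensHom_induction with
    | zero => rw [comp_zero, map_zero, map_zero, zero_comp]
    | add a a' h h' => rw [Preadditive.comp_add, map_add, map_add, h, h', Preadditive.add_comp]
    | tmul f g =>
      induction b using tensHom_induction with
      | zero => rw [zero_comp, map_zero, map_zero, comp_zero]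
      | add b b' h h' =>
        rw [Preadditive.add_comp, map_add, map_add, h, h', Preadditive.comp_add]
      | tmul f' g' => rfl

instance : (opTensRight K X Y).Additive where
  map_add {_ _ a b} := map_add (opTensRightMap K X Y) a.unop b.unop

instance : (opTensRight K X Y).Linear K where
  map_smul a r := map_smul (opTensRightMap K X Y) r a.unop

instance : (opTensLeft K X Y).Additive where
  map_add {_ _ a b} := map_add (opTensLeftMap K X Y) a.unop b.unop

instance : (opTensLeft K X Y).Linear K where
  map_smul a r := map_smul (opTensLeftMap K X Y) r a.unop

end TwoVariables

section Box

variable {K : Type u} [Field K]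
  {C : Type u} [Category.{u} C] [Preadditive C] [Linear K C]
  {D : Type u} [Category.{u} D] [Preadditive D] [Linear K D]
  {A : Type w} [Category.{v} A] [Abelian A] [Linear K A] [HasCoproducts.{u} A]

/-- `F ⊠_C G : D → A`, `D ↦ F ⊗_C G(-, D)`, for `F : C → A` and `G : Cᵒᵖ ⊗_K D → Mod(K)`. -/
noncomputable def box (F : LinFun K C A) (G : LinMod K (Tens K Cᵒᵖ D)) : LinFun K D A :=
  ⟨(curry G).obj ⋙ tensFunctor F, inferInstance, inferInstance⟩

end Box

end KCat

/-! Both sides are computed by dimension shifting in the variable `H`. The functors (F ⊠_C G) ⊗ -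
and F ⊗ (G ⊠_D -) are naturally isomorphic, because both represent the balanced families of
morphisms F(e, c) ⟶ Z indexed by G(c, d) and H(d, e) (`nonempty_tensAssoc`). This is the case i = 0.
For i > 0, take a short exact sequence 0 → H' → P → H → 0 with P a coproduct of representables. On
the left P is projective, so Tor₁ of H is the kernel of the map from the tensor product with H' to
the one with P, and Torᵢ₊₁ of H is Torᵢ of H' for i > 0.

The same shift works on the right for two reasons. The sequence stays exact under G ⊠_D -, because
Tor₁ of G and H(-, e) vanishes (`shortExact_map_boxOp`), and G ⊠_D P is acyclic for F ⊗ -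
(`isLeftAcyclic_boxOp_sigma_rep`). The syzygy H' inherits the hypothesis on H, since P(-, e) is
projective over Dᵒᵖ (`projective_curryAt_rep`), so the induction continues.

The acyclicity of G ⊠_D P is where the hypothesis on F and G enters. If P is represented by (d, e),
then G ⊠_D P is E(e, -) ⊗_K G(-, d) (`isIso_indToBoxOp`), that is, `ind e` applied to G(-, d). The
functor `ind e` is exact because K is a field, it preserves projectives because it is left adjoint
to an exact restriction, and F ⊗ `ind e` N is the value at e of F ⊗_C N (`exists_evalTens_iso`).
Hence it turns modules acyclic for F ⊗_C - into modules acyclic for F ⊗ - (`IsLeftAcyclic.transfer`,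
`IsLeftAcyclic.ind`). Coproducts of such modules remain acyclic by AB4 (`IsLeftAcyclic.sigma`). -/

namespace KCat

/-! ### Projective resolutions and the long exact sequence of left derived functors -/

section LongExactSequence

open HomologicalComplex

/-- The cone of an identity is contractible. -/
noncomputable def coneIdNullHomotopy {M : Type*} [Category* M] [Preadditive M]
    [HasBinaryBiproducts M] (P : ChainComplex M ℕ) :
    Homotopy (𝟙 (homotopyCofiber (𝟙 P))) 0 where
  hom i j := if hij : (ComplexShape.down ℕ).Rel j i then
    homotopyCofiber.sndX (𝟙 P) i ≫ homotopyCofiber.inlX (𝟙 P) i j hij else 0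
  zero i j hij := dif_neg hij
  comm i := by
    have hp : (ComplexShape.down ℕ).Rel (i + 1) i := rfl
    rw [prevD_eq _ hp, dif_pos hp]
    -- In degree 0 the cone has only the summand `P.X 0`, so the term of the homotopy coming from
    -- below is absent.
    cases i with
    | zero =>
      rw [dNext_eq_zero _ _ (by simp)]
      have h0 : ¬ (ComplexShape.down ℕ).Rel 0 ((ComplexShape.down ℕ).next 0) := by simp
      have := homotopyCofiber.inlX_d' (𝟙 P) 1 0 hp h0
      simp [this, homotopyCofiber.sndX_inrX _ _ h0]
    | succ i =>
      have hi : (ComplexShape.down ℕ).Rel (i + 1) i := rfl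
      rw [dNext_eq _ hi, dif_pos hi]
      apply homotopyCofiber.ext_to_X (𝟙 P) (i + 1) i hi <;>
        simp [homotopyCofiber.d_sndX_assoc _ _ _ hi, homotopyCofiber.inlX_d _ _ _ _ hp hi]

variable {M : Type*} [Category* M] [Abelian M]

instance projective_homotopyCofiber {P Q : ChainComplex M ℕ} (φ : P ⟶ Q)
    [∀ n, Projective (P.X n)] [∀ n, Projective (Q.X n)] (n : ℕ) :
    Projective ((homotopyCofiber φ).X n) := by
  cases n with
  | zero => exact Projective.of_iso (homotopyCofiber.XIso φ 0 (by simp)).symm inferInstance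
  | succ n =>
    exact Projective.of_iso (homotopyCofiber.XIsoBiprod φ (n + 1) n rfl).symm inferInstance

/-- A contractible summand is invisible up to homotopy: `biprod.inl` is a homotopy inverse of the
projection. This allows a resolution to be enlarged by the cone of an identity. -/
theorem quasiIso_biprod_fst_of_nullHomotopic {P Q : ChainComplex M ℕ} (h : Homotopy (𝟙 Q) 0) :
    QuasiIso (biprod.fst : P ⊞ Q ⟶ P) := by
  let e : HomotopyEquiv (P ⊞ Q) P :=
    { hom := biprod.fst
      inv := biprod.inl
      homotopyHomInvId :=
        ((Homotopy.ofEq (by simp)).trans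
          ((Homotopy.refl (biprod.fst ≫ biprod.inl : P ⊞ Q ⟶ P ⊞ Q)).add
            ((((h.symm.compRight biprod.inr).compLeft biprod.snd))))).trans
          (Homotopy.ofEq (by simp))
      homotopyInvHomId := Homotopy.ofEq (by simp) }
  exact e.quasiIso_hom

/-- Every short exact sequence is resolved by a degreewise split short exact sequence of
projective resolutions. -/
theorem exists_projectiveResolution_shortExact [EnoughProjectives M] {S : ShortComplex M}
    (hS : S.ShortExact) :
    ∃ (P₁ : ProjectiveResolution S.X₁) (P₂ : ProjectiveResolution S.X₂)
      (P₃ : ProjectiveResolution S.X₃) (f : P₁.complex ⟶ P₂.complex)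
      (g : P₂.complex ⟶ P₃.complex) (w : f ≫ g = 0),
      (∀ n, Nonempty (((ShortComplex.mk f g w).map (eval M _ n)).Splitting)) ∧
      f ≫ P₂.π = P₁.π ≫ (ChainComplex.single₀ M).map S.f ∧
      g ≫ P₃.π = P₂.π ≫ (ChainComplex.single₀ M).map S.g := by
  let P₁ := projectiveResolution S.X₁
  let R₂ := projectiveResolution S.X₂
  have hq := quasiIso_biprod_fst_of_nullHomotopic (P := R₂.complex)
    (coneIdNullHomotopy P₁.complex)
  -- Adding the contractible cone of `P₁.complex` does not change the homology, but makes room for a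
  -- degreewise split embedding of `P₁.complex`, as in a mapping cylinder.
  let P₂ : ProjectiveResolution S.X₂ :=
    { complex := R₂.complex ⊞ homotopyCofiber (𝟙 P₁.complex)
      projective := fun n => Projective.of_iso (biprodXIso _ _ n).symm inferInstance
      π := biprod.fst ≫ R₂.π }
  let φ := ProjectiveResolution.lift S.f P₁ R₂
  let f : P₁.complex ⟶ P₂.complex := biprod.lift φ (homotopyCofiber.inr _)
  have hf : f ≫ P₂.π = P₁.π ≫ (ChainComplex.single₀ M).map S.f := by
    simp [f, P₂, φ]
  -- The component of `f` in the cone is the inclusion of a degreewise summand; projecting back to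
  -- that summand retracts `f`.
  let r (n : ℕ) : P₂.complex.X n ⟶ P₁.complex.X n :=
    (biprod.snd : P₂.complex ⟶ _).f n ≫ homotopyCofiber.sndX (𝟙 P₁.complex) n
  have hr (n : ℕ) : f.f n ≫ r n = 𝟙 _ := by
    have : f ≫ biprod.snd = homotopyCofiber.inr _ := biprod.lift_snd _ _
    rw [← Category.assoc, ← HomologicalComplex.comp_f, this]
    simp
  have : ∀ n, Mono (f.f n) := fun n => mono_of_mono_fac (hr n)
  have : Mono f := mono_of_mono_f f this
  let R : ShortComplex (ChainComplex M ℕ) := ShortComplex.mk f (cokernel.π f) (by simp)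
  have hR : R.ShortExact := { exact := ShortComplex.exact_cokernel f }
  have sp (n : ℕ) : (R.map (eval M _ n)).Splitting :=
    ShortComplex.Splitting.ofExactOfRetraction _ (hR.map_of_exact (eval M _ n)).exact (r n) (hr n)
      (hR.map_of_exact (eval M _ n)).epi_g
  have hz : f ≫ P₂.π ≫ (ChainComplex.single₀ M).map S.g = 0 := by
    rw [← Category.assoc, hf, Category.assoc, ← Functor.map_comp, S.zero, Functor.map_zero,
      comp_zero]
  let π₃ : cokernel f ⟶ (ChainComplex.single₀ M).obj S.X₃ := cokernel.desc f _ hz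
  have hg : cokernel.π f ≫ π₃ = P₂.π ≫ (ChainComplex.single₀ M).map S.g := cokernel.π_desc _ _ _
  let ψ : R ⟶ S.map (ChainComplex.single₀ M) :=
    { τ₁ := P₁.π, τ₂ := P₂.π, τ₃ := π₃, comm₁₂ := hf.symm, comm₂₃ := hg.symm }
  -- Two out of three: the maps on the first two terms are quasi-isomorphisms, hence so is the map
  -- induced on the cokernel.
  have hψ : QuasiIso π₃ :=
    HomologySequence.quasiIso_τ₃ ψ hR (hS.map_of_exact (ChainComplex.single₀ M))
      P₁.quasiIso P₂.quasiIso
  let P₃ : ProjectiveResolution S.X₃ :=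
    { complex := cokernel f
      -- The cokernel of a degreewise split monomorphism is degreewise a retract of the middle term.
      projective := fun n =>
        have := P₂.projective n
        Retract.projective (Y := P₂.complex.X n) ⟨(sp n).s, _, (sp n).s_g⟩
      π := π₃
      quasiIso := hψ }
  exact ⟨P₁, P₂, P₃, f, cokernel.π f, by simp, fun n => ⟨sp n⟩, hf, hg⟩

variable {N : Type*} [Category* N] [Abelian N]

/-- Transports exactness from the homology of chosen resolutions to the derived functors; the
equations for `f` and `g` have the shape in which `leftDerived_map_eq` expresses a derived morphism.
-/
theorem exists_exact_of_iso {S : ShortComplex N} (hS : S.Exact) {X Y Z : N} (a : X ≅ S.X₁)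
    (b : Y ≅ S.X₂) (c : Z ≅ S.X₃) {f : X ⟶ Y} {g : Y ⟶ Z} (hf : f = a.hom ≫ S.f ≫ b.inv)
    (hg : g = b.hom ≫ S.g ≫ c.inv) : ∃ w, (ShortComplex.mk f g w).Exact := by
  have w : f ≫ g = 0 := by simp [hf, hg]
  refine ⟨w, ShortComplex.exact_of_iso (ShortComplex.isoMk a b c ?_ ?_).symm hS⟩
  · simp [hf]
  · simp [hg]

/-- The long exact sequence of left derived functors. -/
theorem exists_leftDerived_δ [EnoughProjectives M] (T : M ⥤ N) [T.Additive] {S : ShortComplex M}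
    (hS : S.ShortExact) (n : ℕ) :
    ∃ (δ : (T.leftDerived (n + 1)).obj S.X₃ ⟶ (T.leftDerived n).obj S.X₁)
      (w₁ : δ ≫ (T.leftDerived n).map S.f = 0)
      (w₂ : (T.leftDerived n).map S.f ≫ (T.leftDerived n).map S.g = 0)
      (w₃ : (T.leftDerived (n + 1)).map S.g ≫ δ = 0),
      (ShortComplex.mk _ _ w₁).Exact ∧ (ShortComplex.mk _ _ w₂).Exact ∧
      (ShortComplex.mk _ _ w₃).Exact := by
  obtain ⟨P₁, P₂, P₃, f, g, w, sp, hf, hg⟩ := exists_projectiveResolution_shortExact hS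
  let R := (ShortComplex.mk f g w).map (T.mapHomologicalComplex (ComplexShape.down ℕ))
  -- An additive functor preserves the degreewise splittings, so the sequence of complexes stays
  -- exact although `T` need not be.
  have hR : R.ShortExact := shortExact_of_degreewise_shortExact _ fun n =>
    ((sp n).some.map T).shortExact
  have ef : ∀ n, (T.leftDerived n).map S.f = (P₁.isoLeftDerivedObj T n).hom ≫
    homologyMap R.f n ≫ (P₂.isoLeftDerivedObj T n).inv := fun n => T.leftDerived_map_eq n S.f f hf
  have eg : ∀ n, (T.leftDerived n).map S.g = (P₂.isoLeftDerivedObj T n).hom ≫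
    homologyMap R.g n ≫ (P₃.isoLeftDerivedObj T n).inv := fun n => T.leftDerived_map_eq n S.g g hg
  have hn : (ComplexShape.down ℕ).Rel (n + 1) n := rfl
  obtain ⟨w₁, h₁⟩ := exists_exact_of_iso (hR.homology_exact₁ (n + 1) n hn)
    (P₃.isoLeftDerivedObj T (n + 1)) (P₁.isoLeftDerivedObj T n) (P₂.isoLeftDerivedObj T n)
    rfl (ef n)
  obtain ⟨w₂, h₂⟩ := exists_exact_of_iso (hR.homology_exact₂ n)
    (P₁.isoLeftDerivedObj T n) (P₂.isoLeftDerivedObj T n) (P₃.isoLeftDerivedObj T n)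
    (ef n) (eg n)
  obtain ⟨w₃, h₃⟩ := exists_exact_of_iso (hR.homology_exact₃ (n + 1) n hn)
    (P₂.isoLeftDerivedObj T (n + 1)) (P₃.isoLeftDerivedObj T (n + 1)) (P₁.isoLeftDerivedObj T n)
    (eg (n + 1)) rfl
  exact ⟨_, w₁, w₂, w₃, h₁, h₂, h₃⟩

/-- `X` is acyclic for `T`: its higher left derived objects vanish. -/
def IsLeftAcyclic [EnoughProjectives M] (T : M ⥤ N) [T.Additive] (X : M) : Prop :=
  ∀ n, 0 < n → IsZero ((T.leftDerived n).obj X)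

section

variable [EnoughProjectives M] (T : M ⥤ N) [T.Additive] {S : ShortComplex M}

theorem isLeftAcyclic_of_projective (X : M) [Projective X] : IsLeftAcyclic T X := by
  rintro (_ | n) hn
  · exact (lt_irrefl _ hn).elim
  · exact T.isZero_leftDerived_obj_projective_succ n X

variable {T} in
theorem IsLeftAcyclic.of_iso {X Y : M} (h : IsLeftAcyclic T X) (e : X ≅ Y) : IsLeftAcyclic T Y :=
  fun n hn => (h n hn).of_iso ((T.leftDerived n).mapIso e.symm)

variable {T} in
-- In the long exact sequence a derived object of `S.X₁` lies between that of `S.X₃` one degree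
-- higher and that of `S.X₂`.
theorem IsLeftAcyclic.X₁ (hS : S.ShortExact) (h₂ : IsLeftAcyclic T S.X₂)
    (h₃ : IsLeftAcyclic T S.X₃) : IsLeftAcyclic T S.X₁ := fun n hn => by
  obtain ⟨δ, w₁, _, _, e, _, _⟩ := exists_leftDerived_δ T hS n
  exact e.isZero_of_both_zeros ((h₃ _ (Nat.succ_pos n)).eq_of_src _ _)
    ((h₂ n hn).eq_of_tgt _ _)

/-- Dimension shifting. -/
theorem nonempty_leftDerived_shift (hS : S.ShortExact) (h₂ : IsLeftAcyclic T S.X₂) {n : ℕ}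
    (hn : 0 < n) :
    Nonempty ((T.leftDerived (n + 1)).obj S.X₃ ≅ (T.leftDerived n).obj S.X₁) := by
  obtain ⟨δ, w₁, _, w₃, e₁, _, e₃⟩ := exists_leftDerived_δ T hS n
  have : Mono δ := e₃.mono_g ((h₂ _ (Nat.succ_pos n)).eq_of_src _ _)
  have : Epi δ := e₁.epi_f ((h₂ n hn).eq_of_tgt _ _)
  have := isIso_of_mono_of_epi δ
  exact ⟨asIso δ⟩

/-- The bottom of dimension shifting: since L₁T vanishes on `S.X₂`, the connecting morphism is a
kernel of L₀T(`S.f`), and right exactness identifies L₀T with `T`. -/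
theorem nonempty_leftDerived_one_iso_kernel [PreservesFiniteColimits T] (hS : S.ShortExact)
    (h₂ : IsLeftAcyclic T S.X₂) :
    Nonempty ((T.leftDerived 1).obj S.X₃ ≅ kernel (T.map S.f)) := by
  obtain ⟨δ, w₁, _, w₃, e₁, _, e₃⟩ := exists_leftDerived_δ T hS 0
  have : Mono δ := e₃.mono_g ((h₂ _ Nat.one_pos).eq_of_src _ _)
  refine ⟨IsLimit.conePointUniqueUpToIso e₁.fIsKernel (kernelIsKernel _) ≪≫
    kernel.mapIso _ _ (T.leftDerivedZeroIsoSelf.app _) (T.leftDerivedZeroIsoSelf.app _) ?_⟩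
  exact T.leftDerivedZeroIsoSelf.hom.naturality _

/-- The kernel is the image of L₁T(`S.X₃`) under the connecting morphism, and this object vanishes.
-/
theorem mono_map_of_isLeftAcyclic [PreservesFiniteColimits T] (hS : S.ShortExact)
    (h₃ : IsLeftAcyclic T S.X₃) : Mono (T.map S.f) := by
  obtain ⟨δ, w₁, _, w₃, e₁, _, e₃⟩ := exists_leftDerived_δ T hS 0
  have h : Mono ((T.leftDerived 0).map S.f) := e₁.mono_g ((h₃ _ Nat.one_pos).eq_of_src _ _)
  rw [← NatIso.naturality_1 T.leftDerivedZeroIsoSelf S.f]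
  infer_instance

end

end LongExactSequence

/-! ### Pointwise exactness in categories of K-functors -/

section Evaluation

variable {K : Type u} [Field K] {C : Type u} [Category.{u} C] [Preadditive C] [Linear K C]
  {A : Type w} [Category.{v} A]

section

variable [Preadditive A] [Linear K A]

/-- Evaluation at an object, as a functor on `Fun_K(C, A)`. -/
def evalFun (x : C) : LinFun K C A ⥤ A := (isLin K).ι ⋙ (evaluation C A).obj x

instance (x : C) : (evalFun (K := K) (A := A) x).Additive where

instance (x : C) : (evalFun (K := K) (A := A) x).Linear K where

instance (x : C) (J : Type*) [Category* J] [HasColimitsOfShape J A] :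
    PreservesColimitsOfShape J (evalFun (K := K) (A := A) x) :=
  inferInstanceAs (PreservesColimitsOfShape J ((isLin K).ι ⋙ (evaluation C A).obj x))

instance (x : C) (J : Type*) [Category* J] [HasLimitsOfShape J A] :
    PreservesLimitsOfShape J (evalFun (K := K) (A := A) x) :=
  inferInstanceAs (PreservesLimitsOfShape J ((isLin K).ι ⋙ (evaluation C A).obj x))

instance (x : C) [HasFiniteColimits A] : PreservesFiniteColimits (evalFun (K := K) (A := A) x) where
  preservesFiniteColimits _ _ _ := inferInstance

instance (x : C) [HasFiniteLimits A] : PreservesFiniteLimits (evalFun (K := K) (A := A) x) where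
  preservesFiniteLimits _ _ _ := inferInstance

/-- Colimits of `K`-functors are computed pointwise. -/
noncomputable def isColimitOfEval {J : Type*} [Category* J] {D : J ⥤ LinFun K C A} (c : Cocone D)
    (hc : ∀ x, IsColimit ((evalFun x).mapCocone c)) : IsColimit c :=
  isColimitOfReflects (isLin K).ι (evaluationJointlyReflectsColimits _ hc)

theorem mono_of_eval {F G : LinFun K C A} (α : F ⟶ G) [∀ x, Mono (α.hom.app x)] : Mono α where
  right_cancellation f g h := linFun_hom_ext fun x => by
    rw [← cancel_mono (α.hom.app x)]
    exact congrArg (fun β => β.hom.app x) h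

theorem isIso_of_eval {F G : LinFun K C A} (α : F ⟶ G) (h : ∀ x, IsIso (α.hom.app x)) :
    IsIso α := by
  have : IsIso α.hom := NatIso.isIso_of_isIso_app _
  have : IsIso ((isLin K).ι.map α) := this
  exact isIso_of_fully_faithful (isLin K).ι α

end

section

variable [Abelian A] [Linear K A]

instance epi_app {F G : LinFun K C A} (α : F ⟶ G) [Epi α] (x : C) : Epi (α.hom.app x) :=
  inferInstanceAs (Epi ((evalFun x).map α))

instance mono_app {F G : LinFun K C A} (α : F ⟶ G) [Mono α] (x : C) : Mono (α.hom.app x) :=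
  inferInstanceAs (Mono ((evalFun x).map α))

theorem epi_of_eval {F G : LinFun K C A} (α : F ⟶ G) (h : ∀ x, Epi (α.hom.app x)) : Epi α := by
  have : Epi ((isLin K).ι.map α) := (NatTrans.epi_iff_epi_app _).2 h
  exact (isLin K).ι.epi_of_epi_map this

theorem isZero_of_eval {F : LinFun K C A} (h : ∀ x, IsZero (F.obj.obj x)) : IsZero F := by
  rw [IsZero.iff_id_eq_zero]
  exact ObjectProperty.hom_ext _ (NatTrans.ext (funext fun x => (h x).eq_of_src _ _))

theorem shortExact_map_eval {S : ShortComplex (LinFun K C A)} (hS : S.ShortExact) (x : C) :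
    (S.map (evalFun x)).ShortExact := hS.map_of_exact _

/-- Short exactness is pointwise. -/
theorem shortExact_of_eval {S : ShortComplex (LinFun K C A)}
    (h : ∀ x, (S.map (evalFun x)).ShortExact) : S.ShortExact where
  exact := by
    rw [ShortComplex.exact_iff_isZero_homology]
    -- Evaluation is exact, so it commutes with homology.
    refine isZero_of_eval fun x => ?_
    exact ((ShortComplex.exact_iff_isZero_homology _).1 (h x).exact).of_iso
      (S.mapHomologyIso (evalFun x)).symm
  mono_f := have (x : C) : Mono (S.f.hom.app x) := (h x).mono_f; mono_of_eval S.f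
  epi_g := epi_of_eval S.g fun x => (h x).epi_g

end

end Evaluation

/-! ### Restriction along a K-functor -/

section Precomposition

variable {K : Type u} [Field K]
  {X : Type u} [Category.{u} X] [Preadditive X] [Linear K X]
  {Y : Type u} [Category.{u} Y] [Preadditive Y] [Linear K Y]
  {A : Type w} [Category.{v} A]

/-- Restriction along a `K`-functor, as a functor. -/
def precompFunctor [Preadditive A] [Linear K A] (P : X ⥤ Y) [P.Additive] [P.Linear K] :
    LinFun K Y A ⥤ LinFun K X A where
  obj := precomp P
  map α := ObjectProperty.homMk (Functor.whiskerLeft P α.hom)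

variable (P : X ⥤ Y) [P.Additive] [P.Linear K]

instance [Preadditive A] [Linear K A] : (precompFunctor (K := K) (A := A) P).Additive where

instance [Preadditive A] [Linear K A] (J : Type*) [Category* J] [HasColimitsOfShape J A] :
    PreservesColimitsOfShape J (precompFunctor (K := K) (A := A) P) where
  preservesColimit := ⟨fun hc =>
    ⟨isColimitOfEval _ fun x => isColimitOfPreserves (evalFun (P.obj x)) hc⟩⟩

theorem shortExact_map_precomp [Abelian A] [Linear K A] {S : ShortComplex (LinFun K Y A)}
    (hS : S.ShortExact) : (S.map (precompFunctor P)).ShortExact :=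
  shortExact_of_eval fun x => shortExact_map_eval hS (P.obj x)

end Precomposition

/-! ### The tensor-hom adjunction -/

section Adjunction

variable {K : Type u} [Field K] {C : Type u} [Category.{u} C] [Preadditive C] [Linear K C]

section

variable {A : Type w} [Category.{u} A] [Preadditive A] [Linear K A]

/-- The functor `c ↦ Hom_A(F(c), B)`. -/
def homFun (F : LinFun K C A) (B : A) : LinMod K Cᵒᵖ :=
  ⟨F.obj.op ⋙ (linearYoneda K A).obj B, inferInstance,
    ⟨fun f r => by
      ext (g : F.obj.obj _ ⟶ B)
      exact (congrArg (· ≫ g) (F.obj.map_smul r f.unop)).trans (Linear.smul_comp _ _ _ _ _ _)⟩⟩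

end

variable {A : Type w} [Category.{u} A] [Abelian A] [Linear K A] [HasCoproducts.{u} A]

/-- The universal property of `F ⊗_C G` as a bijection. -/
noncomputable def tensHomEquiv (F : LinFun K C A) (G : LinMod K Cᵒᵖ) (B : A) :
    (tensObj F G ⟶ B) ≃ (G ⟶ homFun F B) where
  toFun f := ObjectProperty.homMk
    { app := fun c => ModuleCat.ofHom
        (Y := (homFun F B).obj.obj c)
        { toFun := fun x => (tensι F (c := c.unop) x ≫ f : F.obj.obj c.unop ⟶ B)
          map_add' := fun x y => by rw [tensι_add, Preadditive.add_comp]; rfl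
          map_smul' := fun r x => by rw [tensι_smul, Linear.smul_comp]; rfl }
      naturality := fun c c' g => by
        ext x
        exact (congrArg (· ≫ f) (tensι_nat F g.unop x)).trans (Category.assoc _ _ _) }
  invFun α := tensDesc (fun c x => (α.hom.app (op c)).hom x)
    (fun c x y => map_add _ _ _) (fun c r x => map_smul _ _ _)
    (fun c c' f x => congr($(α.hom.naturality f.op).hom x))
  left_inv f := tens_hom_ext fun c x => tensι_desc _ _ _ _ _
  right_inv α := linFun_hom_ext fun c => by
    ext x
    exact tensι_desc _ _ _ _ _

/-- `F ⊗_C -` is left adjoint to `B ↦ Hom_A(F(-), B)`. -/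
theorem tensFunctor_isLeftAdjoint (F : LinFun K C A) : (tensFunctor F).IsLeftAdjoint := by
  refine (Adjunction.adjunctionOfEquivRight (F := tensFunctor F) (G_obj := homFun F)
    (fun G B => tensHomEquiv F G B) ?_).isLeftAdjoint
  intro G G' B f g
  refine linFun_hom_ext fun c => ?_
  ext x
  exact (Category.assoc _ _ _).symm.trans (congrArg (· ≫ g) (tensι_map F f x))

/-- Commutation with coproducts and right exactness of F ⊗_C - come from the adjunction. For this
the morphisms of `A` live in `u`, so that the Hom spaces are objects of `ModuleCat.{u} K`. -/
instance (F : LinFun K C A) : PreservesColimitsOfSize.{u, u} (tensFunctor F) :=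
  have := tensFunctor_isLeftAdjoint F
  inferInstance

instance (F : LinFun K C A) : PreservesFiniteColimits (tensFunctor F) :=
  have := tensFunctor_isLeftAdjoint F
  inferInstance

end Adjunction

/-! ### Generators and relations under a right exact functor -/

section MapTens

variable {K : Type u} [Field K] {C : Type u} [Category.{u} C] [Preadditive C] [Linear K C]
  {A : Type w} [Category.{v} A] [Abelian A] [Linear K A] [HasCoproducts.{u} A]
  {A' : Type*} [Category* A'] (U : A ⥤ A') [PreservesFiniteColimits U]
  [∀ J : Type u, PreservesColimitsOfShape (Discrete J) U]
  {F : LinFun K C A} {G : LinMod K Cᵒᵖ}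

/-- `U` preserves the presentation of F ⊗_C G by generators and relations. With `U` an evaluation
functor, this gives access to the values of a tensor product formed in a functor category. -/
theorem mapTens_hom_ext {X : A'} {f g : U.obj (tensObj F G) ⟶ X}
    (h : ∀ (c : C) (x : G.obj.obj (op c)), U.map (tensι F x) ≫ f = U.map (tensι F x) ≫ g) :
    f = g := by
  rw [← cancel_epi (U.map (tensπ F G))]
  refine (isColimitOfHasCoproductOfPreservesColimit U
    (fun p : TensGen G => F.obj.obj p.1)).hom_ext fun ⟨p⟩ => ?_
  have := h p.1 p.2
  rw [tensι, U.map_comp, Category.assoc, Category.assoc] at this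
  exact this

/-- The universal property of `U(F ⊗_C G)` for a right exact `K`-functor `U` that preserves
coproducts. -/
theorem exists_mapTensDesc [Preadditive A'] [Linear K A'] [U.Additive] [U.Linear K] {X : A'}
    (φ : ∀ c : C, G.obj.obj (op c) → (U.obj (F.obj.obj c) ⟶ X))
    (hadd : ∀ c x y, φ c (x + y) = φ c x + φ c y)
    (hsmul : ∀ c (r : K) x, φ c (r • x) = r • φ c x)
    (hnat : ∀ (c c' : C) (f : c ⟶ c') (x : G.obj.obj (op c')),
      φ c ((G.obj.map f.op).hom x) = U.map (F.obj.map f) ≫ φ c' x) :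
    ∃ d : U.obj (tensObj F G) ⟶ X, ∀ (c : C) (x : G.obj.obj (op c)),
      U.map (tensι F x) ≫ d = φ c x := by
  let hc := isColimitOfHasCoproductOfPreservesColimit U (fun p : TensGen G => F.obj.obj p.1)
  let e := hc.desc (Cofan.mk X fun p : TensGen G => φ p.1 p.2)
  have he (c : C) (x : G.obj.obj (op c)) : U.map (genι F G c x) ≫ e = φ c x :=
    hc.fac (Cofan.mk X fun p : TensGen G => φ p.1 p.2) ⟨⟨c, x⟩⟩
  have hz : U.map (relAll F G) ≫ e = 0 := by
    refine (isColimitOfHasCoproductOfPreservesColimit U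
      (fun ρ : (Σ c : C, TensRel G c) => F.obj.obj ρ.1)).hom_ext fun ⟨ρ⟩ => ?_
    refine Eq.trans (b := U.map (relMap F G ρ.1 ρ.2) ≫ e) ?_ ?_
    · refine (Category.assoc _ _ _).symm.trans (congrArg (· ≫ e) ?_)
      refine (U.map_comp _ _).symm.trans (congrArg U.map ?_)
      exact Sigma.ι_desc _ _
    · refine Eq.trans ?_ comp_zero.symm
      rcases ρ with ⟨c, ⟨x, y⟩ | ⟨r, x⟩ | ⟨c', f, x⟩⟩
      · rw [relMap, Functor.map_sub, Functor.map_add, Preadditive.sub_comp, Preadditive.add_comp,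
          he, he, he, hadd, sub_self]
      · rw [relMap, Functor.map_sub, Functor.map_smul, Preadditive.sub_comp, Linear.smul_comp,
          he, he, hsmul, sub_self]
      · rw [relMap, Functor.map_sub, Functor.map_comp, Preadditive.sub_comp, Category.assoc, he,
          he, hnat, sub_self]
  let hk := isColimitOfHasCokernelOfPreservesColimit U (relAll F G)
  refine ⟨hk.desc (CokernelCofork.ofπ e hz), fun c x => ?_⟩
  rw [tensι, U.map_comp]
  refine (Category.assoc _ _ _).trans (Eq.trans (congrArg _ ?_) (he c x))
  exact hk.fac (CokernelCofork.ofπ e hz) WalkingParallelPair.one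

end MapTens

/-! ### Transfer of acyclicity along an exact functor -/

section Transfer

variable {M : Type*} [Category* M] [Abelian M] {N : Type*} [Category* N] [Abelian N]

theorem isZero_kernel_of_mono {X Y : M} (f : X ⟶ Y) [Mono f] : IsZero (kernel f) :=
  (isZero_zero M).of_iso (kernel.ofMono f)

theorem exists_shortExact_projective [EnoughProjectives M] (X : M) :
    ∃ (Y Q : M) (f : Y ⟶ Q) (g : Q ⟶ X) (w : f ≫ g = 0),
      Projective Q ∧ (ShortComplex.mk f g w).ShortExact :=
  ⟨_, _, kernel.ι (Projective.π X), Projective.π X, kernel.condition _, inferInstance,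
    { exact := ShortComplex.exact_kernel _ }⟩

/-- A functor `I` between abelian categories that is exact, sends projectives to `T`-acyclic
objects, and detects monomorphisms well enough, sends `T₀`-acyclic objects to `T`-acyclic ones. -/
theorem IsLeftAcyclic.transfer {M₀ : Type*} [Category* M₀] [Abelian M₀]
    {N₀ : Type*} [Category* N₀] [Abelian N₀] [EnoughProjectives M₀] [EnoughProjectives M]
    (T₀ : M₀ ⥤ N₀) [T₀.Additive] [PreservesFiniteColimits T₀]
    (T : M ⥤ N) [T.Additive] [PreservesFiniteColimits T] (I : M₀ ⥤ M) [I.PreservesZeroMorphisms]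
    (hI : ∀ S : ShortComplex M₀, S.ShortExact → (S.map I).ShortExact)
    (hP : ∀ Q : M₀, Projective Q → IsLeftAcyclic T (I.obj Q))
    (hm : ∀ {X Y : M₀} (f : X ⟶ Y), Mono (T₀.map f) → Mono (T.map (I.map f)))
    {X : M₀} (hX : IsLeftAcyclic T₀ X) : IsLeftAcyclic T (I.obj X) := by
  intro n hn
  -- In degree one the derived object is the kernel of `T.map (I.map f)`; higher degrees pass to the
  -- syzygy `Y`, which is again acyclic for `T₀`.
  induction n, hn using Nat.le_induction generalizing X with
  | base =>
    obtain ⟨Y, Q, f, g, w, hQ, hS⟩ := exists_shortExact_projective X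
    obtain ⟨e⟩ := nonempty_leftDerived_one_iso_kernel T (hI _ hS) (hP Q hQ)
    have := hm f (mono_map_of_isLeftAcyclic T₀ hS hX)
    exact (isZero_kernel_of_mono (T.map (I.map f))).of_iso e
  | succ n hn ih =>
    obtain ⟨Y, Q, f, g, w, hQ, hS⟩ := exists_shortExact_projective X
    obtain ⟨e⟩ := nonempty_leftDerived_shift T (hI _ hS) (hP Q hQ) hn
    exact (ih (.X₁ hS (isLeftAcyclic_of_projective T₀ Q) hX)).of_iso e

end Transfer

/-! ### Coproducts of acyclic objects -/

section Coproducts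

variable {M : Type*} [Category* M] [Abelian M] {N : Type*} [Category* N] [Abelian N]
  {J : Type*} [HasColimitsOfShape (Discrete J) M] [HasColimitsOfShape (Discrete J) N]

omit [Abelian M] [Abelian N] in
-- The comparison isomorphisms of coproducts identify the two morphisms.
theorem mono_map_sigmaMap_iff (T : M ⥤ N) [PreservesColimitsOfShape (Discrete J) T]
    {X Y : J → M} (f : ∀ j, X j ⟶ Y j) :
    Mono (T.map (Limits.Sigma.map f)) ↔ Mono (Limits.Sigma.map fun j => T.map (f j)) := by
  have h : sigmaComparison T X ≫ T.map (Limits.Sigma.map f) =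
      Limits.Sigma.map (fun j => T.map (f j)) ≫ sigmaComparison T Y :=
    Sigma.hom_ext _ _ fun j => by
      rw [ι_comp_sigmaComparison_assoc, ← T.map_comp, Sigma.ι_map, Sigma.ι_map_assoc,
        ι_comp_sigmaComparison, T.map_comp]
  rw [← mono_comp_iff_of_mono (Limits.Sigma.map fun j => T.map (f j)) (sigmaComparison T Y), ← h]
  exact ⟨fun _ => inferInstance, fun h' => by
    have : T.map (Limits.Sigma.map f) =
      inv (sigmaComparison T X) ≫ sigmaComparison T X ≫ T.map (Limits.Sigma.map f) := by simp
    rw [this]; infer_instance⟩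

theorem mono_sigmaMap [HasExactColimitsOfShape (Discrete J) M]
    {X Y : J → M} (f : ∀ j, X j ⟶ Y j) [∀ j, Mono (f j)] : Mono (Limits.Sigma.map f) := by
  have := HasExactColimitsOfShape.preservesFiniteLimits (J := Discrete J) (C := M)
  have : ∀ j, Mono ((Discrete.natTrans fun j => f j.as :
    Discrete.functor X ⟶ Discrete.functor Y).app j) := fun j => inferInstanceAs (Mono (f j.as))
  have := NatTrans.mono_of_mono_app (Discrete.natTrans fun j => f j.as :
    Discrete.functor X ⟶ Discrete.functor Y)
  exact inferInstanceAs (Mono (colim.map (Discrete.natTrans fun j => f j.as :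
    Discrete.functor X ⟶ Discrete.functor Y)))

/-- Coproducts are always right exact, so only monicity of the first morphism has to be assumed. -/
theorem shortExact_sigma (S : J → ShortComplex M) (hS : ∀ j, (S j).ShortExact)
    [Mono (Limits.Sigma.map fun j => (S j).f)] :
    (ShortComplex.mk (Limits.Sigma.map fun j => (S j).f) (Limits.Sigma.map fun j => (S j).g)
      (Sigma.hom_ext _ _ fun j => by simp)).ShortExact := by
  have (j : J) := (hS j).epi_g
  have e : Epi (Limits.Sigma.map fun j => (S j).g) := inferInstance
  have hz {Z : M} (k : (∐ fun j => (S j).X₂) ⟶ Z)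
      (hk : (Limits.Sigma.map fun j => (S j).f) ≫ k = 0) (j : J) :
      (S j).f ≫ Sigma.ι (fun j => (S j).X₂) j ≫ k = 0 := by
    have := Sigma.ι (fun j => (S j).X₁) j ≫= hk
    simpa using this
  exact
    { exact := ShortComplex.exact_of_g_is_cokernel _ <|
        CokernelCofork.IsColimit.ofπ _ _
          (fun k hk => Sigma.desc fun j =>
            (hS j).gIsCokernel.desc (CokernelCofork.ofπ
              (Sigma.ι (fun j => (S j).X₂) j ≫ k) (hz k hk j)))
          (fun k hk => Sigma.hom_ext _ _ fun j => by
            have := (hS j).gIsCokernel.fac (CokernelCofork.ofπ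
              (Sigma.ι (fun j => (S j).X₂) j ≫ k) (hz k hk j))
              WalkingParallelPair.one
            simp only [Sigma.ι_map_assoc, Sigma.ι_desc]
            exact this)
          (fun k hk b hb => by
            rw [← cancel_epi (Limits.Sigma.map fun j => (S j).g)]
            refine hb.trans (Sigma.hom_ext _ _ fun j => ?_)
            have := (hS j).gIsCokernel.fac (CokernelCofork.ofπ
              (Sigma.ι (fun j => (S j).X₂) j ≫ k) (hz k hk j))
              WalkingParallelPair.one
            simp only [Sigma.ι_map_assoc, Sigma.ι_desc]
            exact this.symm) }

omit [Abelian M] in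
theorem projective_sigma (Q : J → M) (hQ : ∀ j, Projective (Q j)) : Projective (∐ Q) where
  factors f e _ := ⟨Sigma.desc fun j => Projective.factorThru (Sigma.ι Q j ≫ f) e,
    Sigma.hom_ext _ _ fun j => by simp⟩

/-- If coproducts are exact, a coproduct of acyclic objects is acyclic. -/
theorem IsLeftAcyclic.sigma [EnoughProjectives M] (T : M ⥤ N) [T.Additive]
    [PreservesFiniteColimits T] [PreservesColimitsOfShape (Discrete J) T]
    [HasExactColimitsOfShape (Discrete J) N]
    (hM : ∀ {X Y : J → M} (f : ∀ j, X j ⟶ Y j), (∀ j, Mono (f j)) → Mono (Limits.Sigma.map f))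
    {X : J → M} (hX : ∀ j, IsLeftAcyclic T (X j)) : IsLeftAcyclic T (∐ X) := by
  intro n hn
  induction n, hn using Nat.le_induction generalizing X with
  | base =>
    choose Y Q f g w hQ hS using fun j => exists_shortExact_projective (X j)
    have := hM f fun j => (hS j).mono_f
    have := projective_sigma Q hQ
    obtain ⟨e⟩ := nonempty_leftDerived_one_iso_kernel T (shortExact_sigma _ hS)
      (isLeftAcyclic_of_projective T (∐ Q))
    have (j : J) := mono_map_of_isLeftAcyclic T (hS j) (hX j)
    -- `T` commutes with coproducts, and coproducts in `N` preserve monomorphisms: this is the use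
    -- of AB4.
    have := (mono_map_sigmaMap_iff T f).2 (mono_sigmaMap fun j => T.map (f j))
    exact (isZero_kernel_of_mono (T.map (Limits.Sigma.map f))).of_iso e
  | succ n hn ih =>
    choose Y Q f g w hQ hS using fun j => exists_shortExact_projective (X j)
    have := hM f fun j => (hS j).mono_f
    have := projective_sigma Q hQ
    obtain ⟨e⟩ := nonempty_leftDerived_shift T (shortExact_sigma _ hS)
      (isLeftAcyclic_of_projective T (∐ Q)) hn
    exact (ih fun j => .X₁ (hS j) (isLeftAcyclic_of_projective T (Q j)) (hX j)).of_iso e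

end Coproducts

/-! ### Free presentations of modules -/

section LinMod

variable {K : Type u} [Field K] {C : Type u} [Category.{u} C] [Preadditive C] [Linear K C]

/-- Coproducts of modules are computed pointwise, and those of vector spaces are exact. -/
theorem linMod_mono_sigmaMap {J : Type u} {X Y : J → LinMod K C} (f : ∀ j, X j ⟶ Y j)
    (hf : ∀ j, Mono (f j)) : Mono (Limits.Sigma.map f) := by
  have (c : C) : Mono ((Limits.Sigma.map f).hom.app c) := by
    have (j : J) : Mono ((evalFun c).map (f j)) := inferInstance
    exact (mono_map_sigmaMap_iff (evalFun c) f).2 (mono_sigmaMap fun j => (evalFun c).map (f j))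
  exact mono_of_eval _

/-- Every module is presented by a coproduct of representables. -/
theorem exists_shortExact_rep (G : LinMod K C) :
    ∃ (J : Type u) (x : J → C) (G' : LinMod K C) (f : G' ⟶ ∐ fun j => rep K (x j))
      (g : (∐ fun j => rep K (x j)) ⟶ G) (w : f ≫ g = 0), (ShortComplex.mk f g w).ShortExact := by
  let g : (∐ fun p : (Σ X : C, G.obj.obj X) => rep K p.1) ⟶ G := Sigma.desc fun p => repDesc G p.2
  have : Epi g := by
    refine epi_of_eval g fun X => (ModuleCat.epi_iff_surjective _).2 fun x => ?_
    -- By Yoneda, `x` is the image of the identity in the summand indexed by `(X, x)`.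
    refine ⟨((Sigma.ι (fun p : (Σ X : C, G.obj.obj X) => rep K p.1) ⟨X, x⟩).hom.app X).hom
      (𝟙 X : X ⟶ X), ?_⟩
    have h : Sigma.ι (fun p : (Σ X : C, G.obj.obj X) => rep K p.1) ⟨X, x⟩ ≫ g = repDesc G x :=
      Sigma.ι_desc _ _
    exact congr((($h).hom.app X).hom (𝟙 X : X ⟶ X)).trans (repDesc_id G x)
  exact ⟨_, _, _, kernel.ι g, g, kernel.condition g, { exact := ShortComplex.exact_kernel _ }⟩

end LinMod

/-! ### Fixing one variable, and morphisms checked on pure tensors -/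

section Insertion

variable (K : Type u) [Field K]
  {X : Type u} [Category.{u} X] [Preadditive X] [Linear K X]
  {Y : Type u} [Category.{u} Y] [Preadditive Y] [Linear K Y]

/-- The functor `x ↦ (x, y)`. -/
noncomputable def insFst (y : Y) : X ⥤ Tens K X Y where
  obj x := ⟨x, y⟩
  map f := tensHom K (X := ⟨_, y⟩) (Y := ⟨_, y⟩) f (𝟙 y)
  map_id x := rfl
  map_comp f g := by rw [tensHom_comp, Category.comp_id]

/-- The functor `y ↦ (x, y)`. -/
noncomputable def insSnd (x : X) : Y ⥤ Tens K X Y where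
  obj y := ⟨x, y⟩
  map f := tensHom K (X := ⟨x, _⟩) (Y := ⟨x, _⟩) (𝟙 x) f
  map_id x := rfl
  map_comp f g := by rw [tensHom_comp, Category.comp_id]

instance (y : Y) : (insFst K y (X := X)).Additive where
  map_add := tensHom_add_left K _ _ _

instance (y : Y) : (insFst K y (X := X)).Linear K where
  map_smul _ _ := tensHom_smul_left K _ _ _

instance (x : X) : (insSnd K x (Y := Y)).Additive where
  map_add := tensHom_add_right K _ _ _

instance (x : X) : (insSnd K x (Y := Y)).Linear K where
  map_smul _ _ := tensHom_smul_right K _ _ _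

instance (P : X ⥤ Y) [P.Additive] [P.Linear K] : P.op.Linear K where
  map_smul f r := congrArg Quiver.Hom.op (P.map_smul r f.unop)

variable {K} {A : Type w} [Category.{v} A] [Preadditive A] [Linear K A]

/-- `L ↦ L(-, y)` as a functor. -/
noncomputable abbrev curryAt (y : Y) : LinFun K (Tens K X Y) A ⥤ LinFun K X A :=
  precompFunctor (insFst K y)

/-- Naturality on `X ⊗_K Y` may be checked on pure tensors. -/
noncomputable def tensHomMk {L L' : LinFun K (Tens K X Y) A}
    (app : ∀ P, L.obj.obj P ⟶ L'.obj.obj P)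
    (nat : ∀ {P Q : Tens K X Y} (f : P.fst ⟶ Q.fst) (g : P.snd ⟶ Q.snd),
      L.obj.map (tensHom K f g) ≫ app Q = app P ≫ L'.obj.map (tensHom K f g)) : L ⟶ L' :=
  ObjectProperty.homMk
    { app := app
      naturality := fun P Q a => by
        induction a using tensHom_induction with
        | zero => rw [Functor.map_zero, Functor.map_zero, zero_comp, comp_zero]
        | add a b ha hb =>
          rw [Functor.map_add, Functor.map_add, Preadditive.add_comp, Preadditive.comp_add, ha, hb]
        | tmul f g => exact nat f g }

/-- `M ↦ uncurry M` as a functor. -/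
noncomputable def uncurryFunctor : LinFun K Y (LinFun K X A) ⥤ LinFun K (Tens K Y X) A where
  obj := uncurry
  map {M M'} β := tensHomMk (fun P => (β.hom.app P.fst).hom.app P.snd) fun {P Q} f g => by
    change uncurryMap M P Q (tensHom K f g) ≫ _ = _ ≫ uncurryMap M' P Q (tensHom K f g)
    rw [uncurryMap_tensHom, uncurryMap_tensHom, Category.assoc]
    have h₁ := (β.hom.app Q.fst).hom.naturality g
    have h₂ := congrArg (fun γ => γ.hom.app P.snd) (β.hom.naturality f)
    rw [h₁]
    exact (Category.assoc _ _ _).symm.trans ((congrArg (· ≫ _) h₂).trans (Category.assoc _ _ _))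

end Insertion

/-! ### Functoriality and exactness of the box product -/

section BoxFunctor

variable {K : Type u} [Field K]
  {C : Type u} [Category.{u} C] [Preadditive C] [Linear K C]
  {D : Type u} [Category.{u} D] [Preadditive D] [Linear K D]
  {A : Type w} [Category.{v} A] [Abelian A] [Linear K A] [HasCoproducts.{u} A]

/-- `G ↦ F ⊠_C G` as a functor. -/
noncomputable def boxFunctor (F : LinFun K C A) : LinMod K (Tens K Cᵒᵖ D) ⥤ LinFun K D A where
  obj := box F
  map {G G'} α := ObjectProperty.homMk
    { app := fun d => (tensFunctor F).map ((curryAt d).map α)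
      naturality := fun d d' f => by
        refine ((tensFunctor F).map_comp _ _).symm.trans
          (Eq.trans (congrArg _ ?_) ((tensFunctor F).map_comp _ _))
        exact linFun_hom_ext fun c => α.hom.naturality _ }
  map_id G := linFun_hom_ext fun d => by
    refine Eq.trans ?_ ((tensFunctor F).map_id _)
    exact congrArg (tensFunctor F).map ((curryAt d).map_id G)
  map_comp α β := linFun_hom_ext fun d => by
    refine Eq.trans ?_ ((tensFunctor F).map_comp _ _)
    exact congrArg (tensFunctor F).map ((curryAt d).map_comp α β)

end BoxFunctor

section Transpose

variable {K : Type u} [Field K]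
  {C : Type u} [Category.{u} C] [Preadditive C] [Linear K C]
  {D : Type u} [Category.{u} D] [Preadditive D] [Linear K D]
  {E : Type u} [Category.{u} E] [Preadditive E] [Linear K E]

/-- `H ↦ G ⊠_D H`, with values in the modules over `(Eᵒᵖ ⊗_K C)ᵒᵖ`. -/
noncomputable def boxOp (G : LinMod K (Tens K Cᵒᵖ D)) :
    LinMod K (Tens K Dᵒᵖ E) ⥤ LinMod K (Tens K Eᵒᵖ C)ᵒᵖ :=
  boxFunctor (curry G) ⋙ uncurryFunctor ⋙ precompFunctor (opTensLeft K E C)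

variable (G : LinMod K (Tens K Cᵒᵖ D))

instance : (boxOp (E := E) G).Additive where
  map_add := linFun_hom_ext fun P =>
    (curryAt P.unop.fst.unop ⋙ tensFunctor (curry G) ⋙ evalFun (op P.unop.snd)).map_add

/-- At each object, G ⊠_D - is restriction to one variable, followed by G ⊗_D - and an evaluation,
and each of these preserves coproducts. -/
instance (J : Type u) : PreservesColimitsOfShape (Discrete J) (boxOp (E := E) G) where
  preservesColimit := ⟨fun hc => ⟨isColimitOfEval _ fun P =>
    isColimitOfPreserves
      (curryAt P.unop.fst.unop ⋙ tensFunctor (curry G) ⋙ evalFun (op P.unop.snd)) hc⟩⟩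

/-- `G ⊠_D -` preserves the short exact sequences whose last term is acyclic. -/
theorem shortExact_map_boxOp {S : ShortComplex (LinMod K (Tens K Dᵒᵖ E))} (hS : S.ShortExact)
    (h : ∀ e, IsLeftAcyclic (tensFunctor (curry G)) ((curry S.X₃).obj.obj e)) :
    (S.map (boxOp G)).ShortExact := by
  refine shortExact_of_eval fun P => ?_
  have hS' : (S.map (curryAt P.unop.fst.unop)).ShortExact := shortExact_map_precomp _ hS
  -- Exactness on the left is the vanishing of Tor₁ on the last term; the rest is right exactness of
  -- the tensor product.
  have hm : Mono ((tensFunctor (curry G)).map (S.map (curryAt P.unop.fst.unop)).f) :=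
    mono_map_of_isLeftAcyclic _ hS' (h _)
  have he := hS'.epi_g
  have h' : ((S.map (curryAt P.unop.fst.unop)).map (tensFunctor (curry G))).ShortExact :=
    { exact := hS'.exact.map_of_epi_of_preservesCokernel _ hS'.epi_g inferInstance
      mono_f := hm
      epi_g := inferInstanceAs (Epi ((tensFunctor (curry G)).map _)) }
  exact shortExact_map_eval h' (op P.unop.snd)

end Transpose

/-! ### Tensoring modules with vector spaces -/

theorem lTensor_injective {K : Type u} [Field K] (V : ModuleCat.{u} K) {X Y : ModuleCat.{u} K}
    {f : X →ₗ[K] Y} (hf : Function.Injective f) : Function.Injective (LinearMap.lTensor V f) :=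
  Module.Flat.lTensor_preserves_injective_linearMap f hf

section VecTens

variable {K : Type u} [Field K]
  {B : Type u} [Category.{u} B] [Preadditive B] [Linear K B]
  {E : Type u} [Category.{u} E] [Preadditive E] [Linear K E]

/-- The module `V ⊗_K N`. -/
noncomputable def vecTens (V : ModuleCat.{u} K) (N : LinMod K B) : LinMod K B where
  obj :=
    { obj := fun b => ModuleCat.of K (V ⊗[K] N.obj.obj b)
      map := fun f => ModuleCat.ofHom (LinearMap.lTensor V (N.obj.map f).hom)
      map_id := fun b => by ext : 1; simp
      map_comp := fun f g => by ext : 1; simp [LinearMap.lTensor_comp] }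
  property := ⟨⟨fun {b b' f g} => by
      ext : 1
      change LinearMap.lTensor V (N.obj.map (f + g)).hom =
        LinearMap.lTensor V (N.obj.map f).hom + LinearMap.lTensor V (N.obj.map g).hom
      rw [N.obj.map_add, ← LinearMap.lTensor_add]; rfl⟩,
    ⟨fun {b b'} f r => by
      ext : 1
      change LinearMap.lTensor V (N.obj.map (r • f)).hom =
        r • LinearMap.lTensor V (N.obj.map f).hom
      rw [N.obj.map_smul, ← LinearMap.lTensor_smul]; rfl⟩⟩

/-- The functor `e ↦ V(e) ⊗_K N`. -/
noncomputable def vecTensFun (V : LinMod K E) (N : LinMod K B) : LinFun K E (LinMod K B) where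
  obj :=
    { obj := fun e => vecTens (V.obj.obj e) N
      map := fun g => ObjectProperty.homMk
        { app := fun b => ModuleCat.ofHom (LinearMap.rTensor (N.obj.obj b) (V.obj.map g).hom)
          naturality := fun b b' f => by
            ext : 1
            refine TensorProduct.ext' fun v x => rfl }
      map_id := fun e => linFun_hom_ext fun b => by
        ext : 1
        refine TensorProduct.ext' fun v x => ?_
        exact congr($(V.obj.map_id e).hom v ⊗ₜ[K] x)
      map_comp := fun f g => linFun_hom_ext fun b => by
        ext : 1
        refine TensorProduct.ext' fun v x => ?_
        exact congr($(V.obj.map_comp f g).hom v ⊗ₜ[K] x) }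
  property := ⟨⟨fun {e e' f g} => linFun_hom_ext fun b => by
      ext : 1
      refine TensorProduct.ext' fun v x => ?_
      exact congr($(V.obj.map_add (f := f) (g := g)).hom v ⊗ₜ[K] x).trans
        (TensorProduct.add_tmul _ _ _)⟩,
    ⟨fun {e e'} f r => linFun_hom_ext fun b => by
      ext : 1
      refine TensorProduct.ext' fun v x => ?_
      exact congr($(V.obj.map_smul r f).hom v ⊗ₜ[K] x)⟩⟩

/-- `N ↦ V ⊗_K N` as a functor. -/
noncomputable def vecTensFunctor (V : LinMod K E) : LinMod K B ⥤ LinFun K E (LinMod K B) where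
  obj N := vecTensFun V N
  map α := ObjectProperty.homMk
    { app := fun e => ObjectProperty.homMk
        { app := fun b => ModuleCat.ofHom (LinearMap.lTensor (V.obj.obj e) (α.hom.app b).hom)
          naturality := fun b b' f => by
            ext : 1
            refine TensorProduct.ext' fun v x => ?_
            exact congr(v ⊗ₜ[K] $(α.hom.naturality f).hom x) }
      naturality := fun e e' g => linFun_hom_ext fun b => by
        ext : 1
        refine TensorProduct.ext' fun v x => rfl }
  map_id N := linFun_hom_ext fun e => linFun_hom_ext fun b => by
    ext : 1
    exact TensorProduct.ext' fun v x => rfl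
  map_comp α β := linFun_hom_ext fun e => linFun_hom_ext fun b => by
    ext : 1
    exact TensorProduct.ext' fun v x => rfl

end VecTens

/-! ### The induction functor and its right adjoint -/

section Induction

variable {K : Type u} [Field K]
  {C : Type u} [Category.{u} C] [Preadditive C] [Linear K C]
  {E : Type u} [Category.{u} E] [Preadditive E] [Linear K E]

/-- `N ↦ E(e, -) ⊗_K N`, with values in the modules over `(Eᵒᵖ ⊗_K C)ᵒᵖ`. -/
noncomputable def ind (e : E) : LinMod K Cᵒᵖ ⥤ LinMod K (Tens K Eᵒᵖ C)ᵒᵖ :=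
  vecTensFunctor (rep K e) ⋙ uncurryFunctor ⋙ precompFunctor (opTensLeft K E C)

variable (e : E)

/-- The elements `g ⊗ x` of `E(e, e') ⊗_K N(c)`. -/
noncomputable abbrev indMk (N : LinMod K Cᵒᵖ) (P : (Tens K Eᵒᵖ C)ᵒᵖ) (g : e ⟶ P.unop.fst.unop)
    (x : N.obj.obj (op P.unop.snd)) : ((ind e).obj N).obj.obj P :=
  (g ⊗ₜ[K] x : (e ⟶ P.unop.fst.unop) ⊗[K] N.obj.obj (op P.unop.snd))

variable {e}

theorem ind_linearMap_ext {N : LinMod K Cᵒᵖ} {P : (Tens K Eᵒᵖ C)ᵒᵖ} {V : ModuleCat.{u} K}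
    {f g : ((ind e).obj N).obj.obj P ⟶ V}
    (h : ∀ a x, f.hom (indMk e N P a x) = g.hom (indMk e N P a x)) : f = g :=
  ModuleCat.hom_ext (TensorProduct.ext' h)

theorem ind_map_indMk (N : LinMod K Cᵒᵖ) {P Q : Tens K Eᵒᵖ C} (u : Q.fst ⟶ P.fst)
    (v : Q.snd ⟶ P.snd) (g : e ⟶ P.fst.unop) (x : N.obj.obj (op P.snd)) :
    (((ind e).obj N).obj.map (tensHom K u v).op).hom (indMk e N (op P) g x) =
      indMk e N (op Q) (g ≫ u.unop) ((N.obj.map v.op).hom x) :=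
  congr(($(uncurryMap_tensHom (vecTensFun (rep K e) N) (P := ⟨P.fst.unop, op P.snd⟩)
    (Q := ⟨Q.fst.unop, op Q.snd⟩) u.unop v.op)).hom (g ⊗ₜ[K] x))

theorem ind_map_app_indMk {N N' : LinMod K Cᵒᵖ} (α : N ⟶ N') (P : (Tens K Eᵒᵖ C)ᵒᵖ)
    (g : e ⟶ P.unop.fst.unop) (x : N.obj.obj (op P.unop.snd)) :
    (((ind e).map α).hom.app P).hom (indMk e N P g x) =
      indMk e N' P g ((α.hom.app (op P.unop.snd)).hom x) := rfl

instance : (ind (K := K) (C := C) e).PreservesZeroMorphisms where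
  map_zero N N' := linFun_hom_ext fun P => ind_linearMap_ext fun a x => by
    rw [ind_map_app_indMk]
    exact TensorProduct.tmul_zero _ _

/-- At each object, `ind e` is tensoring with a Hom space of `E`, which is flat because `K` is a
field. -/
theorem shortExact_map_ind (S : ShortComplex (LinMod K Cᵒᵖ)) (hS : S.ShortExact) :
    (S.map (ind e)).ShortExact := by
  refine shortExact_of_eval fun P => ?_
  have h := shortExact_map_eval hS (op P.unop.snd)
  have hi : Function.Injective (S.map (evalFun (op P.unop.snd))).f.hom :=
    (ModuleCat.mono_iff_injective _).1 h.mono_f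
  have hs : Function.Surjective (S.map (evalFun (op P.unop.snd))).g.hom :=
    (ModuleCat.epi_iff_surjective _).1 h.epi_g
  have hx := (ShortComplex.ShortExact.moduleCat_exact_iff_function_exact _).1 h.exact
  exact
    { exact := (ShortComplex.ShortExact.moduleCat_exact_iff_function_exact _).2
        (lTensor_exact (e ⟶ P.unop.fst.unop) hx hs)
      mono_f := (ModuleCat.mono_iff_injective _).2
        (lTensor_injective ((rep K e).obj.obj P.unop.fst.unop) hi)
      epi_g := (ModuleCat.epi_iff_surjective _).2
        (LinearMap.lTensor_surjective (e ⟶ P.unop.fst.unop) hs) }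

/-- Naturality on `(X ⊗_K Y)ᵒᵖ` may be checked on pure tensors. -/
noncomputable def tensOpHomMk {X Y : Type u} [Category.{u} X] [Preadditive X] [Linear K X]
    [Category.{u} Y] [Preadditive Y] [Linear K Y] {A : Type w} [Category.{v} A] [Preadditive A]
    [Linear K A] {L L' : LinFun K (Tens K X Y)ᵒᵖ A} (app : ∀ P, L.obj.obj P ⟶ L'.obj.obj P)
    (nat : ∀ {P Q : Tens K X Y} (f : Q.fst ⟶ P.fst) (g : Q.snd ⟶ P.snd),
      L.obj.map (tensHom K f g).op ≫ app (op Q) = app (op P) ≫ L'.obj.map (tensHom K f g).op) :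
    L ⟶ L' :=
  ObjectProperty.homMk
    { app := app
      naturality := fun P Q a => by
        obtain ⟨a, rfl⟩ : ∃ a' : Q.unop ⟶ P.unop, a'.op = a := ⟨a.unop, rfl⟩
        induction a using tensHom_induction with
        | zero => rw [op_zero, Functor.map_zero, Functor.map_zero, zero_comp, comp_zero]
        | add a b ha hb =>
          rw [op_add, Functor.map_add, Functor.map_add, Preadditive.add_comp,
            Preadditive.comp_add, ha, hb]
        | tmul f g => exact nat f g }

/-- Restriction to the objects with first component `e`, right adjoint to `ind e`. -/
noncomputable abbrev res (e : E) : LinMod K (Tens K Eᵒᵖ C)ᵒᵖ ⥤ LinMod K Cᵒᵖ :=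
  precompFunctor (insSnd K (op e)).op

/-- The action of `g : e ⟶ e'` on `M(-, c)`, linear in `g`. -/
noncomputable def actFst (M : LinMod K (Tens K Eᵒᵖ C)ᵒᵖ) (e e' : E) (c : C) :
    (e ⟶ e') →ₗ[K] (M.obj.obj (op ⟨op e, c⟩) ⟶ M.obj.obj (op ⟨op e', c⟩)) where
  toFun g := M.obj.map (tensHom K (X := ⟨op e', c⟩) (Y := ⟨op e, c⟩) g.op (𝟙 c)).op
  map_add' g g' := by rw [op_add, tensHom_add_left, op_add, Functor.map_add]
  map_smul' r g := by rw [op_smul, tensHom_smul_left, op_smul, Functor.map_smul]; rfl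

/-- The components of `indDesc`. -/
noncomputable def indDescApp {N : LinMod K Cᵒᵖ} {M : LinMod K (Tens K Eᵒᵖ C)ᵒᵖ}
    (h : N ⟶ (res e).obj M) (P : (Tens K Eᵒᵖ C)ᵒᵖ) :
    ((ind e).obj N).obj.obj P ⟶ M.obj.obj P :=
  let k : N.obj.obj (op P.unop.snd) ⟶ M.obj.obj (op ⟨op e, P.unop.snd⟩) :=
    h.hom.app (op P.unop.snd)
  ModuleCat.ofHom (X := (e ⟶ P.unop.fst.unop) ⊗[K] N.obj.obj (op P.unop.snd))
    (TensorProduct.lift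
      { toFun := fun (g : e ⟶ P.unop.fst.unop) =>
          (k ≫ actFst M e P.unop.fst.unop P.unop.snd g).hom
        map_add' := fun g g' => by rw [map_add, Preadditive.comp_add]; rfl
        map_smul' := fun r g => by rw [map_smul, Linear.comp_smul]; rfl })

theorem indDescApp_indMk {N : LinMod K Cᵒᵖ} {M : LinMod K (Tens K Eᵒᵖ C)ᵒᵖ}
    (h : N ⟶ (res e).obj M) (P : (Tens K Eᵒᵖ C)ᵒᵖ)
    (g : e ⟶ P.unop.fst.unop) (x : N.obj.obj (op P.unop.snd)) :
    (indDescApp h P).hom (indMk e N P g x) =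
      (actFst M e P.unop.fst.unop P.unop.snd g).hom ((h.hom.app (op P.unop.snd)).hom x) := rfl

/-- The morphism `E(e, -) ⊗_K N ⟶ M` attached to a morphism `N ⟶ M(e, -)`. -/
noncomputable def indDesc {N : LinMod K Cᵒᵖ} {M : LinMod K (Tens K Eᵒᵖ C)ᵒᵖ}
    (h : N ⟶ (res e).obj M) : (ind e).obj N ⟶ M :=
  tensOpHomMk (indDescApp h) fun {P Q} f g => ind_linearMap_ext fun a x => by
    have e₁ := congr($(h.hom.naturality g.op).hom x)
    -- Both composites are the pure tensor of `f ≫ a.op` and `g`, so `M` acts in the same way along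
    -- either of them.
    have e₂ : ((insSnd K (op e)).map g).op ≫ ((insFst K Q.snd).map (a ≫ f.unop).op).op =
        ((insFst K P.snd).map a.op).op ≫ (tensHom K f g).op := by
      refine congrArg Quiver.Hom.op ?_
      refine (tensHom_comp K _ _ _ _).trans (Eq.trans ?_ (tensHom_comp K _ _ _ _).symm)
      exact congrArg₂ (tensHom K (X := Q) (Y := ⟨op e, P.snd⟩)) (Category.comp_id (f ≫ a.op))
        ((Category.id_comp g).trans (Category.comp_id g).symm)
    refine (congrArg (indDescApp h (op Q)).hom (ind_map_indMk N f g a x)).trans ?_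
    refine (indDescApp_indMk h (op Q) (a ≫ f.unop) _).trans ?_
    refine (congrArg (actFst M e Q.fst.unop Q.snd (a ≫ f.unop)).hom e₁).trans ?_
    exact congr(($((M.obj.map_comp _ _).symm.trans
      ((congrArg M.obj.map e₂).trans (M.obj.map_comp _ _)))).hom ((h.hom.app (op P.snd)).hom x))

theorem indDesc_indMk {N : LinMod K Cᵒᵖ} {M : LinMod K (Tens K Eᵒᵖ C)ᵒᵖ}
    (h : N ⟶ (res e).obj M) (P : (Tens K Eᵒᵖ C)ᵒᵖ)
    (g : e ⟶ P.unop.fst.unop) (x : N.obj.obj (op P.unop.snd)) :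
    ((indDesc h).hom.app P).hom (indMk e N P g x) =
      (actFst M e P.unop.fst.unop P.unop.snd g).hom
        ((h.hom.app (op P.unop.snd)).hom x) := rfl

/-- The restriction of a morphism `E(e, -) ⊗_K N ⟶ M` to `N`. -/
noncomputable def indRestrict {N : LinMod K Cᵒᵖ} {M : LinMod K (Tens K Eᵒᵖ C)ᵒᵖ}
    (k : (ind e).obj N ⟶ M) : N ⟶ (res e).obj M :=
  ObjectProperty.homMk
    { app := fun c => ModuleCat.ofHom (X := N.obj.obj c) (Y := M.obj.obj (op ⟨op e, c.unop⟩))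
        ((k.hom.app (op ⟨op e, c.unop⟩)).hom ∘ₗ
          TensorProduct.mk K (e ⟶ e) (N.obj.obj c) (𝟙 e))
      naturality := fun c c' f => by
        ext x
        refine Eq.trans (congrArg (k.hom.app (op ⟨op e, c'.unop⟩)).hom ?_)
          congr($(k.hom.naturality ((insSnd K (op e)).map f.unop).op).hom
            (indMk e N (op ⟨op e, c.unop⟩) (𝟙 e) x))
        refine Eq.symm ((ind_map_indMk N (P := ⟨op e, c.unop⟩) (Q := ⟨op e, c'.unop⟩)
          (𝟙 _) f.unop (𝟙 e) x).trans ?_)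
        exact congr(indMk e N (op ⟨op e, c'.unop⟩) $(Category.comp_id (𝟙 e)) _) }

/-- `ind e` is left adjoint to `res e`. -/
theorem ind_hom_ext {N : LinMod K Cᵒᵖ} {M : LinMod K (Tens K Eᵒᵖ C)ᵒᵖ}
    {k k' : (ind e).obj N ⟶ M} (h : indRestrict k = indRestrict k') : k = k' := by
  refine linFun_hom_ext fun P => ind_linearMap_ext fun a x => ?_
  -- The element `a ⊗ x` is obtained from `𝟙 e ⊗ x` by the action of `a`, so `k` is determined by
  -- its restriction.
  have key (k : (ind e).obj N ⟶ M) : (k.hom.app P).hom (indMk e N P a x) =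
      (actFst M e P.unop.fst.unop P.unop.snd a).hom
        (((indRestrict k).hom.app (op P.unop.snd)).hom x) := by
    refine Eq.trans (congrArg (k.hom.app P).hom ?_)
      congr($(k.hom.naturality ((insFst K P.unop.snd).map a.op).op).hom
        (indMk e N (op ⟨op e, P.unop.snd⟩) (𝟙 e) x))
    refine Eq.symm ((ind_map_indMk N (P := ⟨op e, P.unop.snd⟩) (Q := P.unop)
      a.op (𝟙 _) (𝟙 e) x).trans ?_)
    exact congr(indMk e N P $(Category.id_comp a) ($(N.obj.map_id _).hom x))
  rw [key, key, h]

theorem indRestrict_indDesc {N : LinMod K Cᵒᵖ} {M : LinMod K (Tens K Eᵒᵖ C)ᵒᵖ}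
    (h : N ⟶ (res e).obj M) : indRestrict (indDesc h) = h :=
  linFun_hom_ext fun c => by
    ext x
    refine (indDesc_indMk h (op ⟨op e, c.unop⟩) (𝟙 e) x).trans ?_
    exact congr($(M.obj.map_id (op ⟨op e, c.unop⟩)).hom ((h.hom.app c).hom x))

theorem indRestrict_comp {N : LinMod K Cᵒᵖ} {M M' : LinMod K (Tens K Eᵒᵖ C)ᵒᵖ}
    (k : (ind e).obj N ⟶ M) (l : M ⟶ M') :
    indRestrict (k ≫ l) = indRestrict k ≫ (res e).map l := rfl

/-- A left adjoint preserves projectives when its right adjoint preserves epimorphisms; restriction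
does, since epimorphisms of modules are pointwise. -/
theorem projective_ind (Q : LinMod K Cᵒᵖ) [Projective Q] : Projective ((ind e).obj Q) where
  factors {M M'} f p _ := by
    have : Epi ((res e).map p) := epi_of_eval _ fun c => epi_app p (op ⟨op e, c.unop⟩)
    refine ⟨indDesc (Projective.factorThru (indRestrict f) ((res e).map p)), ind_hom_ext ?_⟩
    rw [indRestrict_comp, indRestrict_indDesc, Projective.factorThru_comp]

end Induction

/-! ### Values of a tensor product with a functor of two variables -/

section CurryTens

variable {K : Type u} [Field K]
  {X : Type u} [Category.{u} X] [Preadditive X] [Linear K X]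
  {Y : Type u} [Category.{u} Y] [Preadditive Y] [Linear K Y]
  {A : Type w} [Category.{v} A] [Abelian A] [Linear K A]

/-- Over `X ⊗_K Y`, the compatibility required by `tensDesc` may be checked on pure tensors. -/
theorem tensDesc_nat_of_tensHom {F : LinFun K (Tens K X Y) A}
    {G : LinMod K (Tens K X Y)ᵒᵖ} {Z : A}
    (φ : ∀ P : Tens K X Y, G.obj.obj (op P) →ₗ[K] (F.obj.obj P ⟶ Z))
    (h : ∀ (P Q : Tens K X Y) (f : P.fst ⟶ Q.fst) (g : P.snd ⟶ Q.snd) (z : G.obj.obj (op Q)),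
      φ P ((G.obj.map (tensHom K f g).op).hom z) = F.obj.map (tensHom K f g) ≫ φ Q z)
    (P Q : Tens K X Y) (a : P ⟶ Q) (z : G.obj.obj (op Q)) :
    φ P ((G.obj.map a.op).hom z) = F.obj.map a ≫ φ Q z := by
  induction a using tensHom_induction with
  | zero =>
    rw [op_zero, Functor.map_zero, Functor.map_zero, zero_comp]
    exact map_zero (φ P)
  | add a b ha hb =>
    rw [op_add, Functor.map_add, Functor.map_add, Preadditive.add_comp, ← ha, ← hb]
    exact map_add (φ P) _ _
  | tmul f g => exact h P Q f g z

variable [HasCoproducts.{u} A] (F : LinFun K (Tens K X Y) A) {N : LinMod K Yᵒᵖ}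

/-- The canonical morphism `F(a, y) ⟶ (F ⊗_Y N)(a)` attached to `x ∈ N(y)`. -/
noncomputable def curryι (a : X) {y : Y} (x : N.obj.obj (op y)) :
    F.obj.obj ⟨a, y⟩ ⟶ (tensObj (curry F) N).obj.obj a :=
  (tensι (curry F) x).hom.app a

theorem curryι_add (a : X) {y : Y} (x x' : N.obj.obj (op y)) :
    curryι F a (x + x') = curryι F a x + curryι F a x' :=
  congrArg (fun α => α.hom.app a) (tensι_add (curry F) x x')

theorem curryι_smul (a : X) {y : Y} (r : K) (x : N.obj.obj (op y)) :
    curryι F a (r • x) = r • curryι F a x :=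
  congrArg (fun α => α.hom.app a) (tensι_smul (curry F) r x)

theorem curryι_nat (a : X) {y y' : Y} (f : y ⟶ y') (x : N.obj.obj (op y')) :
    curryι F a ((N.obj.map f.op).hom x) =
      F.obj.map (tensHom K (X := ⟨a, y⟩) (Y := ⟨a, y'⟩) (𝟙 a) f) ≫ curryι F a x :=
  congrArg (fun α => α.hom.app a) (tensι_nat (curry F) f x)

theorem curryι_nat_left {a a' : X} (f : a ⟶ a') {y : Y} (x : N.obj.obj (op y)) :
    F.obj.map (tensHom K (X := ⟨a, y⟩) (Y := ⟨a', y⟩) f (𝟙 y)) ≫ curryι F a' x =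
      curryι F a x ≫ (tensObj (curry F) N).obj.map f :=
  (tensι (curry F) x).hom.naturality f

theorem curryι_map (a : X) {N' : LinMod K Yᵒᵖ} (α : N ⟶ N') {y : Y} (x : N.obj.obj (op y)) :
    curryι F a x ≫ (tensMap (curry F) α).hom.app a = curryι F a ((α.hom.app (op y)).hom x) :=
  congrArg (fun α => α.hom.app a) (tensι_map (curry F) α x)

variable {F}

theorem curryTens_hom_ext {a : X} {Z : A} {f g : (tensObj (curry F) N).obj.obj a ⟶ Z}
    (h : ∀ (y : Y) (x : N.obj.obj (op y)), curryι F a x ≫ f = curryι F a x ≫ g) : f = g :=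
  mapTens_hom_ext (evalFun a) h

theorem exists_curryTensDesc {a : X} {Z : A}
    (φ : ∀ y : Y, N.obj.obj (op y) → (F.obj.obj ⟨a, y⟩ ⟶ Z))
    (hadd : ∀ y x x', φ y (x + x') = φ y x + φ y x')
    (hsmul : ∀ y (r : K) x, φ y (r • x) = r • φ y x)
    (hnat : ∀ (y y' : Y) (f : y ⟶ y') (x : N.obj.obj (op y')),
      φ y ((N.obj.map f.op).hom x) =
        F.obj.map (tensHom K (X := ⟨a, y⟩) (Y := ⟨a, y'⟩) (𝟙 a) f) ≫ φ y' x) :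
    ∃ d : (tensObj (curry F) N).obj.obj a ⟶ Z, ∀ (y : Y) (x : N.obj.obj (op y)),
      curryι F a x ≫ d = φ y x :=
  exists_mapTensDesc (evalFun a) (F := curry F) (G := N) φ hadd hsmul hnat

variable (F) in
/-- The morphism `F(b, y) ⟶ (F ⊗_Y N)(a)` attached to `f : b ⟶ a` and `x ∈ N(y)`, bilinear
in `f` and `x`. -/
noncomputable def curryιLin (a b : X) (y : Y) :
    (b ⟶ a) →ₗ[K] N.obj.obj (op y) →ₗ[K]
      (F.obj.obj ⟨b, y⟩ ⟶ (tensObj (curry F) N).obj.obj a) :=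
  LinearMap.mk₂ K
    (fun f x => F.obj.map (tensHom K (X := ⟨b, y⟩) (Y := ⟨a, y⟩) f (𝟙 y)) ≫ curryι F a x)
    (fun f f' x => by rw [tensHom_add_left, Functor.map_add, Preadditive.add_comp])
    (fun r f x => by rw [tensHom_smul_left, Functor.map_smul, Linear.smul_comp])
    (fun f x x' => by rw [curryι_add, Preadditive.comp_add])
    (fun r f x => by rw [curryι_smul, Linear.comp_smul])

theorem curryιLin_apply (a b : X) (y : Y) (f : b ⟶ a) (x : N.obj.obj (op y)) :
    curryιLin F a b y f x =
      F.obj.map (tensHom K (X := ⟨b, y⟩) (Y := ⟨a, y⟩) f (𝟙 y)) ≫ curryι F a x := rfl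

theorem curryιLin_nat {a b b' : X} {y y' : Y} (u : b' ⟶ b) (v : y' ⟶ y) (f : b ⟶ a)
    (x : N.obj.obj (op y)) :
    curryιLin F a b' y' (u ≫ f) ((N.obj.map v.op).hom x) =
      F.obj.map (tensHom K (X := ⟨b', y'⟩) (Y := ⟨b, y⟩) u v) ≫ curryιLin F a b y f x := by
  rw [curryιLin_apply, curryιLin_apply, curryι_nat, ← Category.assoc, ← Category.assoc,
    ← F.obj.map_comp, ← F.obj.map_comp, tensHom_comp, tensHom_comp, Category.comp_id,
    Category.comp_id, Category.id_comp]

end CurryTens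

/-! ### Tensor products with induced modules -/

section TensInd

variable {K : Type u} [Field K]
  {C : Type u} [Category.{u} C] [Preadditive C] [Linear K C]
  {E : Type u} [Category.{u} E] [Preadditive E] [Linear K E]
  {A : Type w} [Category.{u} A] [Abelian A] [Linear K A] [HasCoproducts.{u} A]

variable (F : LinFun K (Tens K Eᵒᵖ C) A) (e : E) (N : LinMod K Cᵒᵖ)

theorem tensι_indMk_comp {P Q : Tens K Eᵒᵖ C} (u : P.fst ⟶ Q.fst) (v : P.snd ⟶ Q.snd)
    (g : e ⟶ Q.fst.unop) (x : N.obj.obj (op Q.snd)) :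
    F.obj.map (tensHom K u v) ≫ tensι F (indMk e N (op Q) g x) =
      tensι F (indMk e N (op P) (g ≫ u.unop) ((N.obj.map v.op).hom x)) := by
  rw [← tensι_nat, ind_map_indMk]

variable {F e N} in
theorem tensInd_hom_ext {Z : A} {f g : tensObj F ((ind e).obj N) ⟶ Z}
    (h : ∀ (P : Tens K Eᵒᵖ C) (a : e ⟶ P.fst.unop) (x : N.obj.obj (op P.snd)),
      tensι F (indMk e N (op P) a x) ≫ f = tensι F (indMk e N (op P) a x) ≫ g) : f = g :=
  tens_hom_ext fun P z => TensorProduct.induction_on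
    (motive := fun z : (e ⟶ P.fst.unop) ⊗[K] N.obj.obj (op P.snd) =>
      tensι F (G := (ind e).obj N) (c := P) z ≫ f = tensι F (G := (ind e).obj N) (c := P) z ≫ g) z
    (by
      have h0 : tensι F (G := (ind e).obj N) (c := P) 0 = 0 := by
        simpa using tensι_smul F (G := (ind e).obj N) (c := P) (0 : K) 0
      exact (congrArg (· ≫ f) h0).trans (zero_comp.trans
        (zero_comp.symm.trans (congrArg (· ≫ g) h0.symm))))
    (h P)
    (fun z z' hz hz' => by
      have h1 := tensι_add F (G := (ind e).obj N) (c := P) z z'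
      refine (congrArg (· ≫ f) h1).trans (Eq.trans ?_ (congrArg (· ≫ g) h1.symm))
      exact (Preadditive.add_comp _ _ _ _ _ _).trans ((congrArg₂ (· + ·) hz hz').trans
        (Preadditive.add_comp _ _ _ _ _ _).symm))

theorem exists_evalTens_hom : ∃ κ : (tensObj (curry F) N).obj.obj (op e) ⟶
    tensObj F ((ind e).obj N), ∀ (c : C) (x : N.obj.obj (op c)),
      curryι F (op e) x ≫ κ =
        tensι F (c := ⟨op e, c⟩) (indMk e N (op ⟨op e, c⟩) (𝟙 e) x) := by
  refine exists_curryTensDesc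
    (fun c x => tensι F (c := ⟨op e, c⟩) (indMk e N (op ⟨op e, c⟩) (𝟙 e) x)) ?_ ?_ ?_
  · intro c x y
    rw [← tensι_add]
    exact congrArg (tensι F) (TensorProduct.tmul_add _ _ _)
  · intro c r x
    rw [← tensι_smul]
    exact congrArg (tensι F) (map_smul (TensorProduct.mk K (e ⟶ e) (N.obj.obj (op c)) (𝟙 e)) r x)
  · intro c c' f x
    refine Eq.symm ((tensι_indMk_comp F e N (P := ⟨op e, c⟩) (Q := ⟨op e, c'⟩) (𝟙 _) f
      (𝟙 e) x).trans ?_)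
    exact congr(tensι F (indMk e N (op ⟨op e, c⟩) $(Category.comp_id (𝟙 e)) _))

/-- The formula is forced: `g ⊗ x` arises from `𝟙 e ⊗ x` by the action of `g`, so its generator has
to factor through the action of `g.op` on `F`. -/
theorem exists_evalTens_inv : ∃ κ : tensObj F ((ind e).obj N) ⟶
    (tensObj (curry F) N).obj.obj (op e), ∀ (P : Tens K Eᵒᵖ C) (g : e ⟶ P.fst.unop)
      (x : N.obj.obj (op P.snd)), tensι F (indMk e N (op P) g x) ≫ κ =
        curryιLin F (op e) P.fst P.snd g.op x := by
  let φ (P : Tens K Eᵒᵖ C) : ((ind e).obj N).obj.obj (op P) →ₗ[K]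
      (F.obj.obj P ⟶ (tensObj (curry F) N).obj.obj (op e)) :=
    TensorProduct.lift ((curryιLin F (op e) P.fst P.snd) ∘ₗ opLin e P.fst.unop)
  refine ⟨tensDesc (fun P z => φ P z) (fun P => map_add (φ P)) (fun P => map_smul (φ P))
    (tensDesc_nat_of_tensHom φ fun P Q u v z => ?_), fun P g x => tensι_desc _ _ _ _ _⟩
  have hl : φ P ∘ₗ (((ind e).obj N).obj.map (tensHom K u v).op).hom =
      Linear.leftComp K _ (F.obj.map (tensHom K u v)) ∘ₗ φ Q :=
    TensorProduct.ext' fun g x =>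
      (congrArg (φ P) (ind_map_indMk N u v g x)).trans (curryιLin_nat u v g.op x)
  exact congr($hl z)

/-- The evaluation of `F ⊗_C N` at `e` is `F ⊗ (E(e, -) ⊗_K N)`. -/
theorem exists_evalTens_iso : ∃ κ : (tensObj (curry F) N).obj.obj (op e) ≅
    tensObj F ((ind e).obj N), ∀ (c : C) (x : N.obj.obj (op c)),
      curryι F (op e) x ≫ κ.hom =
        tensι F (c := ⟨op e, c⟩) (indMk e N (op ⟨op e, c⟩) (𝟙 e) x) := by
  obtain ⟨κ, hκ⟩ := exists_evalTens_hom F e N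
  obtain ⟨κ', hκ'⟩ := exists_evalTens_inv F e N
  refine ⟨⟨κ, κ', ?_, ?_⟩, hκ⟩
  · refine curryTens_hom_ext fun c x => ?_
    rw [reassoc_of% (hκ c x), hκ', curryιLin_apply]
    refine Eq.trans ?_ (Category.comp_id _).symm
    exact (congrArg (· ≫ _) (F.obj.map_id ⟨op e, c⟩)).trans (Category.id_comp _)
  · refine tensInd_hom_ext fun P g x => ?_
    rw [reassoc_of% (hκ' P g x), curryιLin_apply, Category.assoc, hκ, Category.comp_id]
    refine (tensι_indMk_comp F e N (Q := ⟨op e, P.snd⟩) g.op (𝟙 _) (𝟙 e) x).trans ?_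
    exact congr(tensι F (indMk e N (op P) $(Category.id_comp g) ($(N.obj.map_id _).hom x)))

/-- Monomorphisms between K-functors into `A` are pointwise, and F ⊗ `ind e` f is the value of F ⊗_C
f at `e`. -/
theorem mono_tensMap_ind {N N' : LinMod K Cᵒᵖ} (f : N ⟶ N')
    [Mono ((tensFunctor (curry F)).map f)] :
    Mono ((tensFunctor F).map ((ind e).map f)) := by
  obtain ⟨κ, hκ⟩ := exists_evalTens_iso F e N
  obtain ⟨κ', hκ'⟩ := exists_evalTens_iso F e N'
  have h : κ.hom ≫ tensMap F ((ind e).map f) = (tensMap (curry F) f).hom.app (op e) ≫ κ'.hom :=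
    curryTens_hom_ext fun c x => by
      rw [reassoc_of% (hκ c x), tensι_map, reassoc_of% (curryι_map F (op e) f x), hκ']
      rfl
  have : Mono ((tensMap (curry F) f).hom.app (op e)) := mono_app ((tensFunctor (curry F)).map f) _
  rw [← Iso.eq_inv_comp] at h
  change Mono (tensMap F ((ind e).map f))
  rw [h]
  infer_instance

/-- `E(e, -) ⊗_K N` is acyclic for `F` if `N` is. -/
theorem IsLeftAcyclic.ind {N : LinMod K Cᵒᵖ} (hN : IsLeftAcyclic (tensFunctor (curry F)) N) :
    IsLeftAcyclic (tensFunctor F) ((ind e).obj N) :=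
  hN.transfer (tensFunctor (curry F)) (tensFunctor F) (KCat.ind e) shortExact_map_ind
    (fun Q _ => have := projective_ind (e := e) Q; isLeftAcyclic_of_projective _ _)
    (fun f _ => mono_tensMap_ind F e f)

end TensInd

/-! ### Representable modules under restriction -/

section Representables

variable {K : Type u} [Field K]
  {X : Type u} [Category.{u} X] [Preadditive X] [Linear K X]
  {Y : Type u} [Category.{u} Y] [Preadditive Y] [Linear K Y]

theorem isIso_of_bijective {M N : LinMod K X} (α : M ⟶ N)
    (h : ∀ x, Function.Bijective (α.hom.app x).hom) : IsIso α :=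
  isIso_of_eval α fun x => (ConcreteCategory.isIso_iff_bijective _).2 (h x)

/-- Restriction along a fully faithful `K`-functor preserves representables. -/
theorem nonempty_rep_iso_precomp (P : X ⥤ Y) [P.Additive] [P.Linear K] [P.Full] [P.Faithful]
    (x : X) : Nonempty (rep K x ≅ (precompFunctor P).obj (rep K (P.obj x))) := by
  have h : IsIso (repDesc ((precompFunctor P).obj (rep K (P.obj x))) (X := x)
      (𝟙 (P.obj x) : P.obj x ⟶ P.obj x)) := by
    refine isIso_of_bijective _ fun x' => ?_
    have : ∀ f : x ⟶ x', ((repDesc ((precompFunctor P).obj (rep K (P.obj x))) (X := x)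
      (𝟙 (P.obj x) : P.obj x ⟶ P.obj x)).hom.app x').hom f = P.map f :=
      fun f => Category.id_comp (P.map f)
    refine ⟨fun f g hfg => P.map_injective ((this f).symm.trans (hfg.trans (this g))),
      fun g => ?_⟩
    obtain ⟨f, hf⟩ := P.map_surjective g
    exact ⟨f, (this f).trans hf⟩
  exact ⟨asIso (repDesc ((precompFunctor P).obj (rep K (P.obj x))) (X := x)
      (𝟙 (P.obj x) : P.obj x ⟶ P.obj x))⟩

theorem opTensRightMap_bijective {P Q : Tens K X Yᵒᵖ} :
    Function.Bijective (opTensRightMap K X Y (P := P) (Q := Q)) :=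
  (TensorProduct.congr
    (LinearEquiv.ofBijective (opLin (K := K) P.fst Q.fst)
      ⟨fun _ _ h => Quiver.Hom.op_inj h, fun f => ⟨f.unop, rfl⟩⟩)
    (LinearEquiv.ofBijective (unopLin (K := K) P.snd Q.snd)
      ⟨fun _ _ h => Quiver.Hom.unop_inj h, fun f => ⟨f.op, rfl⟩⟩)).bijective

instance : (opTensRight K X Y).Full where
  map_surjective a := by
    obtain ⟨b, hb⟩ := opTensRightMap_bijective.2 a
    exact ⟨Quiver.Hom.op b, hb⟩

instance : (opTensRight K X Y).Faithful where
  map_injective h := Quiver.Hom.unop_inj (opTensRightMap_bijective.1 h)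

/-- The identification is fully faithful and hits every object, so the restricted module is again
representable. -/
theorem projective_precomp_opTensRight_rep (P : Tens K Xᵒᵖ Y) :
    Projective ((precompFunctor (opTensRight K X Y)).obj (rep K P)) :=
  Projective.of_iso (nonempty_rep_iso_precomp (opTensRight K X Y)
    (op ⟨P.fst.unop, op P.snd⟩)).some inferInstance

/-- The elements `f ⊗ g` of a representable module over `X ⊗_K Y`. -/
noncomputable abbrev repMk {P : Tens K X Y} {x : X} {y : Y} (f : P.fst ⟶ x) (g : P.snd ⟶ y) :
    ((curryAt y).obj (rep K P)).obj.obj x :=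
  (f ⊗ₜ[K] g : (P.fst ⟶ x) ⊗[K] (P.snd ⟶ y))

theorem curryAt_rep_map_repMk {P : Tens K X Y} {x x' : X} {y : Y} (k : x ⟶ x') (f : P.fst ⟶ x)
    (g : P.snd ⟶ y) : (((curryAt y).obj (rep K P)).obj.map k).hom (repMk f g) =
      repMk (f ≫ k) g :=
  congrArg (repMk (f ≫ k)) (Category.comp_id g)

/-- The restriction of a representable module over `X ⊗_K Y` to one variable is projective. -/
theorem projective_curryAt_rep (P : Tens K X Y) (y : Y) :
    Projective ((curryAt y).obj (rep K P)) where
  factors {M M'} f p _ := by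
    have hp : Function.Surjective (p.hom.app P.fst).hom :=
      (ModuleCat.epi_iff_surjective _).1 (epi_app p P.fst)
    -- The restricted module is X(`P.fst`, -) ⊗_K Y(`P.snd`, y), free on a vector space. A morphism
    -- out of it amounts to a linear map out of Y(`P.snd`, y), and such a map lifts because `K` is a
    -- field.
    let s : (P.snd ⟶ y) →ₗ[K] M'.obj.obj P.fst :=
      (f.hom.app P.fst).hom ∘ₗ TensorProduct.mk K (P.fst ⟶ P.fst) (P.snd ⟶ y) (𝟙 P.fst)
    have : Module.Free K (P.snd ⟶ y) := Module.Free.of_divisionRing K _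
    obtain ⟨t, ht⟩ := Module.projective_lifting_property (p.hom.app P.fst).hom s hp
    let φ (x : X) : (P.fst ⟶ x) →ₗ[K] (P.snd ⟶ y) →ₗ[K] M.obj.obj x :=
      LinearMap.mk₂ K (fun k g => (M.obj.map k).hom (t g))
        (fun k k' g => by rw [Functor.map_add]; rfl)
        (fun r k g => by rw [Functor.map_smul]; rfl)
        (fun k g g' => by rw [map_add, map_add])
        (fun r k g => by rw [map_smul, map_smul])
    let l : (curryAt y).obj (rep K P) ⟶ M := ObjectProperty.homMk
      { app := fun x => ModuleCat.ofHom (X := (P.fst ⟶ x) ⊗[K] (P.snd ⟶ y))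
          (TensorProduct.lift (φ x))
        naturality := fun x x' k => ModuleCat.hom_ext (TensorProduct.ext' fun a g =>
          (congrArg (TensorProduct.lift (φ x')) (curryAt_rep_map_repMk k a g)).trans
            congr(($(M.obj.map_comp a k)).hom (t g))) }
    refine ⟨l, linFun_hom_ext fun x => ModuleCat.hom_ext (TensorProduct.ext' fun k g => ?_)⟩
    have h₁ := congr(($(p.hom.naturality k)).hom (t g))
    have h₂ := congr(($(f.hom.naturality k)).hom (repMk (𝟙 P.fst) g))
    refine h₁.trans ((congrArg (M'.obj.map k).hom congr($ht g)).trans (h₂.symm.trans ?_))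
    refine congrArg (f.hom.app x).hom ((curryAt_rep_map_repMk k (𝟙 P.fst) g).trans ?_)
    exact congr(repMk $(Category.id_comp k) g)

end Representables

/-! ### The box product with a representable module -/

section BoxRepresentable

variable {K : Type u} [Field K]
  {C : Type u} [Category.{u} C] [Preadditive C] [Linear K C]
  {D : Type u} [Category.{u} D] [Preadditive D] [Linear K D]
  {E : Type u} [Category.{u} E] [Preadditive E] [Linear K E]
  (G : LinMod K (Tens K Cᵒᵖ D))

theorem boxOp_map_tensHom (H : LinMod K (Tens K Dᵒᵖ E)) {P Q : Tens K Eᵒᵖ C} (u : Q.fst ⟶ P.fst)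
    (v : Q.snd ⟶ P.snd) : ((boxOp G).obj H).obj.map (tensHom K u v).op =
      (tensMap (curry G) ((curry H).obj.map u.unop)).hom.app (op P.snd) ≫
        (tensObj (curry G) ((curry H).obj.obj Q.fst.unop)).obj.map v.op :=
  uncurryMap_tensHom (box (curry G) H) (P := ⟨P.fst.unop, op P.snd⟩)
    (Q := ⟨Q.fst.unop, op Q.snd⟩) u.unop v.op

/-- The morphism `G(c, d) ⟶ (G ⊠_D H)(c, e)` attached to `h ∈ H(d, e)`. -/
noncomputable def boxι (H : LinMod K (Tens K Dᵒᵖ E)) (P : Tens K Eᵒᵖ C) {d : D}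
    (h : H.obj.obj ⟨op d, P.fst.unop⟩) :
    G.obj.obj ⟨op P.snd, d⟩ ⟶ ((boxOp G).obj H).obj.obj (op P) :=
  curryι G (op P.snd) (N := (curry H).obj.obj P.fst.unop) h

theorem boxι_map (H : LinMod K (Tens K Dᵒᵖ E)) {P Q : Tens K Eᵒᵖ C} (u : Q.fst ⟶ P.fst)
    (v : Q.snd ⟶ P.snd) {d : D} (h : H.obj.obj ⟨op d, P.fst.unop⟩) :
    boxι G H P h ≫ ((boxOp G).obj H).obj.map (tensHom K u v).op =
      G.obj.map (tensHom K (X := ⟨op P.snd, d⟩) (Y := ⟨op Q.snd, d⟩) v.op (𝟙 d)) ≫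
        boxι G H Q ((H.obj.map (tensHom K (X := ⟨op d, P.fst.unop⟩) (Y := ⟨op d, Q.fst.unop⟩)
          (𝟙 (op d)) u.unop)).hom h) := by
  rw [boxOp_map_tensHom]
  refine (Category.assoc _ _ _).symm.trans
    ((congrArg (· ≫ _) (curryι_map G (op P.snd) ((curry H).obj.map u.unop) h)).trans ?_)
  exact (curryι_nat_left G v.op _).symm

theorem boxι_nat (H : LinMod K (Tens K Dᵒᵖ E)) (P : Tens K Eᵒᵖ C) {d d' : D} (f : d ⟶ d')
    (h : H.obj.obj ⟨op d', P.fst.unop⟩) :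
    boxι G H P ((H.obj.map (tensHom K (X := ⟨op d', P.fst.unop⟩) (Y := ⟨op d, P.fst.unop⟩)
      f.op (𝟙 _))).hom h) =
      G.obj.map (tensHom K (X := ⟨op P.snd, d⟩) (Y := ⟨op P.snd, d'⟩) (𝟙 _) f) ≫ boxι G H P h :=
  curryι_nat G (op P.snd) (N := (curry H).obj.obj P.fst.unop) f h

theorem boxι_map_app {H H' : LinMod K (Tens K Dᵒᵖ E)} (α : H ⟶ H') (P : Tens K Eᵒᵖ C) {d : D}
    (h : H.obj.obj ⟨op d, P.fst.unop⟩) :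
    boxι G H P h ≫ ((boxOp G).map α).hom.app (op P) = boxι G H' P ((α.hom.app _).hom h) :=
  curryι_map G (op P.snd) ((curryAt P.fst.unop).map α) h

theorem boxOp_hom_ext {H : LinMod K (Tens K Dᵒᵖ E)} {P : Tens K Eᵒᵖ C} {Z : ModuleCat.{u} K}
    {f g : ((boxOp G).obj H).obj.obj (op P) ⟶ Z}
    (h : ∀ (d : D) (x : H.obj.obj ⟨op d, P.fst.unop⟩), boxι G H P x ≫ f = boxι G H P x ≫ g) :
    f = g :=
  curryTens_hom_ext (F := G) (N := (curry H).obj.obj P.fst.unop) h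

variable (d : D) (e : E)

/-- The comparison morphism `E(e, -) ⊗_K G(-, d) ⟶ G ⊠_D (D(-, d) ⊗_K E(e, -))`. -/
noncomputable def indToBoxOp :
    (ind e).obj ((curry G).obj.obj d) ⟶ (boxOp G).obj (rep K (⟨op d, e⟩ : Tens K Dᵒᵖ E)) :=
  -- By adjunction the morphism is given by its restriction to G(-, d), taken to be the generator
  -- attached to the identity of (d, e).
  indDesc (ObjectProperty.homMk
    { app := fun c => boxι G (rep K (⟨op d, e⟩ : Tens K Dᵒᵖ E)) ⟨op e, c.unop⟩ (d := d)
        (𝟙 (⟨op d, e⟩ : Tens K Dᵒᵖ E) : (⟨op d, e⟩ : Tens K Dᵒᵖ E) ⟶ _)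
      naturality := fun c c' f => by
        refine Eq.symm ((boxι_map G _ (P := ⟨op e, c.unop⟩) (Q := ⟨op e, c'.unop⟩) (𝟙 (op e))
          f.unop _).trans ?_)
        refine congrArg (G.obj.map _ ≫ ·) (congrArg (boxι G _ _) ?_)
        exact Category.comp_id (𝟙 (⟨op d, e⟩ : Tens K Dᵒᵖ E)) })

theorem indToBoxOp_indMk (P : Tens K Eᵒᵖ C) (g : e ⟶ P.fst.unop)
    (x : G.obj.obj ⟨op P.snd, d⟩) :
    ((indToBoxOp G d e).hom.app (op P)).hom (indMk e ((curry G).obj.obj d) (op P) g x) =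
      (boxι G (rep K (⟨op d, e⟩ : Tens K Dᵒᵖ E)) P (d := d)
        (repMk (P := ⟨op d, e⟩) (𝟙 (op d)) g)).hom x := by
  refine (indDesc_indMk (N := (curry G).obj.obj d) _ (op P) g x).trans ?_
  have := congr(($(boxι_map G (rep K (⟨op d, e⟩ : Tens K Dᵒᵖ E)) (P := ⟨op e, P.snd⟩) (Q := P)
    (d := d) g.op (𝟙 P.snd)
    (𝟙 (⟨op d, e⟩ : Tens K Dᵒᵖ E) : (⟨op d, e⟩ : Tens K Dᵒᵖ E) ⟶ _))).hom x)
  refine this.trans ?_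
  have h₂ : ((rep K (⟨op d, e⟩ : Tens K Dᵒᵖ E)).obj.map (tensHom K (X := ⟨op d, e⟩)
      (Y := ⟨op d, P.fst.unop⟩) (𝟙 (op d)) g)).hom (𝟙 (⟨op d, e⟩ : Tens K Dᵒᵖ E) :
        (⟨op d, e⟩ : Tens K Dᵒᵖ E) ⟶ _) = repMk (P := ⟨op d, e⟩) (𝟙 (op d)) g :=
    (tensHom_comp K (X := (⟨op d, e⟩ : Tens K Dᵒᵖ E)) (Y := ⟨op d, e⟩)
      (Z := ⟨op d, P.fst.unop⟩) (𝟙 (op d)) (𝟙 e) (𝟙 (op d)) g).trans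
        (congrArg₂ (tensHom K (X := (⟨op d, e⟩ : Tens K Dᵒᵖ E)) (Y := ⟨op d, P.fst.unop⟩))
          (Category.comp_id _) (Category.id_comp _))
  have h₃ := G.obj.map_id ⟨op P.snd, d⟩
  exact congr((boxι G (rep K (⟨op d, e⟩ : Tens K Dᵒᵖ E)) P (d := d) $h₂).hom (($h₃).hom x))

/-- The morphism `x ↦ g ⊗ x`, linear in `g`. -/
noncomputable def indMkLin (N : LinMod K Cᵒᵖ) (P : Tens K Eᵒᵖ C) :
    (e ⟶ P.fst.unop) →ₗ[K] (N.obj.obj (op P.snd) ⟶ ((ind e).obj N).obj.obj (op P)) where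
  toFun g := ModuleCat.ofHom (TensorProduct.mk K (e ⟶ P.fst.unop) (N.obj.obj (op P.snd)) g)
  map_add' g g' := by rw [map_add]; rfl
  map_smul' r g := by rw [map_smul]; rfl

/-- The components of the inverse of `indToBoxOp` on generators. -/
noncomputable def boxOpToIndAux (P : Tens K Eᵒᵖ C) (d' : D) :
    ((op d ⟶ op d') ⊗[K] (e ⟶ P.fst.unop)) →ₗ[K] (G.obj.obj ⟨op P.snd, d'⟩ ⟶
      ((ind e).obj ((curry G).obj.obj d)).obj.obj (op P)) :=
  TensorProduct.lift <| LinearMap.mk₂ K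
    (fun (k : op d ⟶ op d') g =>
      G.obj.map (tensHom K (X := ⟨op P.snd, d'⟩) (Y := ⟨op P.snd, d⟩) (𝟙 _) k.unop) ≫
        indMkLin e ((curry G).obj.obj d) P g)
    (fun k k' g => by
      rw [unop_add, tensHom_add_right, Functor.map_add]
      exact Preadditive.add_comp _ _ _ _ _ _)
    (fun r k g => by
      rw [unop_smul, tensHom_smul_right, Functor.map_smul]
      exact Linear.smul_comp _ _ _ _ _ _)
    (fun k g g' => by rw [map_add]; exact Preadditive.comp_add _ _ _ _ _ _)
    (fun r k g => by rw [map_smul]; exact Linear.comp_smul _ _ _ _ _ _)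

theorem boxOpToIndAux_nat (P : Tens K Eᵒᵖ C) (d' d'' : D) (f : d' ⟶ d'')
    (x : ((curryAt P.fst.unop).obj (rep K (⟨op d, e⟩ : Tens K Dᵒᵖ E))).obj.obj (op d'')) :
    boxOpToIndAux G d e P d' ((((curryAt P.fst.unop).obj
      (rep K (⟨op d, e⟩ : Tens K Dᵒᵖ E))).obj.map f.op).hom x) =
      G.obj.map (tensHom K (X := ⟨op P.snd, d'⟩) (Y := ⟨op P.snd, d''⟩) (𝟙 _) f) ≫
        boxOpToIndAux G d e P d'' x := by
  have hl : boxOpToIndAux G d e P d' ∘ₗ (((curryAt P.fst.unop).obj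
      (rep K (⟨op d, e⟩ : Tens K Dᵒᵖ E))).obj.map f.op).hom =
      Linear.leftComp K _ (G.obj.map (tensHom K (X := ⟨op P.snd, d'⟩) (Y := ⟨op P.snd, d''⟩)
        (𝟙 _) f)) ∘ₗ boxOpToIndAux G d e P d'' := by
    refine TensorProduct.ext' fun k g => ?_
    refine (congrArg (boxOpToIndAux G d e P d') (curryAt_rep_map_repMk f.op k g)).trans ?_
    refine Eq.trans ?_ (Category.assoc _ _ _)
    refine congrArg (· ≫ indMkLin e ((curry G).obj.obj d) P g) ?_
    rw [← G.obj.map_comp, tensHom_comp, Category.comp_id]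
    rfl
  exact congr($hl x)

/-- The inverse of `indToBoxOp` at a single object. Its naturality in `P` is not needed, because
isomorphisms are detected pointwise. -/
theorem exists_boxOp_rep_desc (P : Tens K Eᵒᵖ C) :
    ∃ κ : ((boxOp G).obj (rep K (⟨op d, e⟩ : Tens K Dᵒᵖ E))).obj.obj (op P) ⟶
      ((ind e).obj ((curry G).obj.obj d)).obj.obj (op P),
      ∀ (d' : D) (x : (op d ⟶ op d') ⊗[K] (e ⟶ P.fst.unop)),
        boxι G (rep K (⟨op d, e⟩ : Tens K Dᵒᵖ E)) P (d := d') x ≫ κ =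
          boxOpToIndAux G d e P d' x :=
  exists_curryTensDesc (F := G)
    (N := (curry (rep K (⟨op d, e⟩ : Tens K Dᵒᵖ E))).obj.obj P.fst.unop)
    (fun d' x => boxOpToIndAux G d e P d' x) (fun d' => map_add (boxOpToIndAux G d e P d'))
    (fun d' => map_smul (boxOpToIndAux G d e P d')) (boxOpToIndAux_nat G d e P)

/-- `x ↦ boxι x` as a linear map. -/
noncomputable def boxιLin (H : LinMod K (Tens K Dᵒᵖ E)) (P : Tens K Eᵒᵖ C) (d : D) :
    H.obj.obj ⟨op d, P.fst.unop⟩ →ₗ[K]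
      (G.obj.obj ⟨op P.snd, d⟩ ⟶ ((boxOp G).obj H).obj.obj (op P)) where
  toFun := boxι G H P
  map_add' := curryι_add G (N := (curry H).obj.obj P.fst.unop) (op P.snd)
  map_smul' := curryι_smul G (N := (curry H).obj.obj P.fst.unop) (op P.snd)

/-- The tensor relation over `D` moves `k` from the representable to `G`, leaving an identity
behind. -/
theorem boxι_repMk (P : Tens K Eᵒᵖ C) {d' : D} (k : op d ⟶ op d') (g : e ⟶ P.fst.unop) :
    boxι G (rep K (⟨op d, e⟩ : Tens K Dᵒᵖ E)) P (d := d') (repMk (P := ⟨op d, e⟩) k g) =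
      G.obj.map (tensHom K (X := ⟨op P.snd, d'⟩) (Y := ⟨op P.snd, d⟩) (𝟙 _) k.unop) ≫
        boxι G (rep K (⟨op d, e⟩ : Tens K Dᵒᵖ E)) P (d := d)
          (repMk (P := ⟨op d, e⟩) (𝟙 (op d)) g) := by
  refine Eq.trans (congrArg (boxι G _ P) ?_)
    (boxι_nat G (rep K (⟨op d, e⟩ : Tens K Dᵒᵖ E)) P k.unop (repMk (P := ⟨op d, e⟩) (𝟙 (op d)) g))
  refine Eq.symm ((curryAt_rep_map_repMk (P := (⟨op d, e⟩ : Tens K Dᵒᵖ E)) k (𝟙 (op d)) g).trans ?_)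
  exact congrArg (fun k => repMk (P := (⟨op d, e⟩ : Tens K Dᵒᵖ E)) k g) (Category.id_comp k)

/-- `G ⊠_D (D(-, d) ⊗_K E(e, -))` is `E(e, -) ⊗_K G(-, d)`. -/
theorem isIso_indToBoxOp : IsIso (indToBoxOp G d e) := by
  refine isIso_of_eval _ fun P => ?_
  obtain ⟨P⟩ := P
  obtain ⟨κ, hκ⟩ := exists_boxOp_rep_desc G d e P
  refine ⟨κ, ?_, ?_⟩
  · refine ind_linearMap_ext fun g x => ?_
    refine (congrArg κ.hom (indToBoxOp_indMk G d e P g x)).trans ?_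
    refine congr(($(hκ d (repMk (P := ⟨op d, e⟩) (𝟙 (op d)) g))).hom x).trans ?_
    exact congr(indMk e ((curry G).obj.obj d) (op P) g (($(G.obj.map_id ⟨op P.snd, d⟩)).hom x))
  · refine boxOp_hom_ext G fun d' x => ?_
    have hl : Linear.rightComp K _ (κ ≫ (indToBoxOp G d e).hom.app (op P)) ∘ₗ
        boxιLin G (rep K (⟨op d, e⟩ : Tens K Dᵒᵖ E)) P d' =
          boxιLin G (rep K (⟨op d, e⟩ : Tens K Dᵒᵖ E)) P d' := by
      refine TensorProduct.ext' fun k g => ?_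
      refine (Category.assoc (boxι G (rep K (⟨op d, e⟩ : Tens K Dᵒᵖ E)) P (d := d')
        (repMk (P := ⟨op d, e⟩) k g)) κ _).symm.trans ?_
      refine (congrArg (· ≫ (indToBoxOp G d e).hom.app (op P))
        (hκ d' (repMk (P := ⟨op d, e⟩) k g))).trans ?_
      refine Eq.trans ?_ (boxι_repMk G d e P k g).symm
      refine (Category.assoc _ _ _).trans (congrArg (G.obj.map (tensHom K (X := ⟨op P.snd, d'⟩)
        (Y := ⟨op P.snd, d⟩) (𝟙 _) k.unop) ≫ ·) ?_)
      exact ModuleCat.hom_ext (LinearMap.ext fun x => indToBoxOp_indMk G d e P g x)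
    exact congr($hl x).trans (Category.comp_id _).symm

end BoxRepresentable

/-! ### Associativity of the tensor product -/

section Associativity

variable {K : Type u} [Field K]
  {C : Type u} [Category.{u} C] [Preadditive C] [Linear K C]
  {D : Type u} [Category.{u} D] [Preadditive D] [Linear K D]
  {E : Type u} [Category.{u} E] [Preadditive E] [Linear K E]
  {A : Type w} [Category.{u} A] [Abelian A] [Linear K A]

/-- The families of morphisms `F(e, c) ⟶ Z`, indexed by `x ∈ G(c, d)` and `h ∈ H(d, e)`, that
both triple tensor products of `F`, `G` and `H` represent. -/
structure Balanced (F : LinFun K (Tens K Eᵒᵖ C) A) (G : LinMod K (Tens K Cᵒᵖ D))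
    (H : LinMod K (Tens K Dᵒᵖ E)) (Z : A) where
  /-- the family, as bilinear maps -/
  app (d : D) (Q : Tens K Eᵒᵖ C) : G.obj.obj ⟨op Q.snd, d⟩ →ₗ[K]
    H.obj.obj ⟨op d, Q.fst.unop⟩ →ₗ[K] (F.obj.obj Q ⟶ Z)
  nat (d : D) {Q Q' : Tens K Eᵒᵖ C} (u : Q.fst ⟶ Q'.fst) (v : Q.snd ⟶ Q'.snd)
    (x : G.obj.obj ⟨op Q'.snd, d⟩) (h : H.obj.obj ⟨op d, Q'.fst.unop⟩) :
    app d Q ((G.obj.map (tensHom K (X := ⟨op Q'.snd, d⟩) (Y := ⟨op Q.snd, d⟩) v.op (𝟙 d))).hom x)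
      ((H.obj.map (tensHom K (X := ⟨op d, Q'.fst.unop⟩) (Y := ⟨op d, Q.fst.unop⟩)
        (𝟙 (op d)) u.unop)).hom h) = F.obj.map (tensHom K u v) ≫ app d Q' x h
  bal {d d' : D} (Q : Tens K Eᵒᵖ C) (f : d ⟶ d') (x : G.obj.obj ⟨op Q.snd, d⟩)
    (h : H.obj.obj ⟨op d', Q.fst.unop⟩) :
    app d Q x ((H.obj.map (tensHom K (X := ⟨op d', Q.fst.unop⟩) (Y := ⟨op d, Q.fst.unop⟩)
      f.op (𝟙 Q.fst.unop))).hom h) =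
    app d' Q ((G.obj.map (tensHom K (X := ⟨op Q.snd, d⟩) (Y := ⟨op Q.snd, d'⟩)
      (𝟙 (op Q.snd)) f)).hom x) h

/-- A balanced family induces linear maps `(G ⊠_D H)(c, e) ⟶ Hom(F(e, c), Z)`. -/
theorem exists_boxOp_desc {F : LinFun K (Tens K Eᵒᵖ C) A} {G : LinMod K (Tens K Cᵒᵖ D)}
    {H : LinMod K (Tens K Dᵒᵖ E)} {Z : A} (β : Balanced F G H Z) (Q : Tens K Eᵒᵖ C) :
    ∃ m : ((boxOp G).obj H).obj.obj (op Q) ⟶ ModuleCat.of K (F.obj.obj Q ⟶ Z),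
      ∀ (d : D) (h : H.obj.obj ⟨op d, Q.fst.unop⟩) (x : G.obj.obj ⟨op Q.snd, d⟩),
        m.hom ((boxι G H Q h).hom x) = β.app d Q x h := by
  obtain ⟨m, hm⟩ := exists_curryTensDesc (F := G) (N := (curry H).obj.obj Q.fst.unop)
    (a := op Q.snd) (Z := ModuleCat.of K (F.obj.obj Q ⟶ Z))
    (fun d h => ModuleCat.ofHom ((β.app d Q).flip h))
    (fun d h h' => congrArg ModuleCat.ofHom (map_add (β.app d Q).flip h h'))
    (fun d r h => congrArg ModuleCat.ofHom (map_smul (β.app d Q).flip r h))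
    (fun d d' f h => ModuleCat.hom_ext (LinearMap.ext fun x => β.bal Q f x h))
  exact ⟨m, fun d h x => congr(($(hm d h)).hom x)⟩

variable [HasCoproducts.{u} A] (F : LinFun K (Tens K Eᵒᵖ C) A) (G : LinMod K (Tens K Cᵒᵖ D))
  (H : LinMod K (Tens K Dᵒᵖ E)) {Z : A}

/-- The functor `F ⊠_C G` on `D ⊗_K Eᵒᵖ`. -/
noncomputable abbrev boxLeft : LinFun K (Tens K D Eᵒᵖ) A := uncurry (box (curry F) G)

/-- The restriction of modules along the identification of `(D ⊗_K Eᵒᵖ)ᵒᵖ` with `Dᵒᵖ ⊗_K E`. -/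
noncomputable abbrev resOp : LinMod K (Tens K Dᵒᵖ E) ⥤ LinMod K (Tens K D Eᵒᵖ)ᵒᵖ :=
  precompFunctor (opTensRight K D E)

/-- The morphism `F(e, c) ⟶ (F ⊠_C G)(d, e)` attached to `x ∈ G(c, d)`. -/
noncomputable def boxLeftι (d : D) (Q : Tens K Eᵒᵖ C) (x : G.obj.obj ⟨op Q.snd, d⟩) :
    F.obj.obj Q ⟶ (boxLeft F G).obj.obj ⟨d, Q.fst⟩ :=
  curryι F Q.fst (N := (curry G).obj.obj d) x

theorem boxLeftι_map {d d' : D} (Q : Tens K Eᵒᵖ C) {e' : Eᵒᵖ} (f : d ⟶ d') (u : Q.fst ⟶ e')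
    (x : G.obj.obj ⟨op Q.snd, d⟩) :
    boxLeftι F G d Q x ≫ (boxLeft F G).obj.map
      (tensHom K (X := ⟨d, Q.fst⟩) (Y := ⟨d', e'⟩) f u) =
      F.obj.map (tensHom K (X := Q) (Y := ⟨e', Q.snd⟩) u (𝟙 Q.snd)) ≫
        boxLeftι F G d' ⟨e', Q.snd⟩ ((G.obj.map (tensHom K (X := ⟨op Q.snd, d⟩)
          (Y := ⟨op Q.snd, d'⟩) (𝟙 (op Q.snd)) f)).hom x) := by
  refine (congrArg (boxLeftι F G d Q x ≫ ·) (uncurryMap_tensHom (box (curry F) G)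
    (P := ⟨d, Q.fst⟩) (Q := ⟨d', e'⟩) f u)).trans ?_
  refine (Category.assoc _ _ _).symm.trans
    ((congrArg (· ≫ _) (curryι_map F Q.fst ((curry G).obj.map f) x)).trans ?_)
  exact (curryι_nat_left F u _).symm

theorem boxLeftι_nat (d : D) (e : Eᵒᵖ) {c c' : C} (v : c ⟶ c') (x : G.obj.obj ⟨op c', d⟩) :
    boxLeftι F G d ⟨e, c⟩ ((G.obj.map (tensHom K (X := ⟨op c', d⟩) (Y := ⟨op c, d⟩)
      v.op (𝟙 d))).hom x) =
      F.obj.map (tensHom K (X := ⟨e, c⟩) (Y := ⟨e, c'⟩) (𝟙 e) v) ≫ boxLeftι F G d ⟨e, c'⟩ x :=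
  curryι_nat F e (N := (curry G).obj.obj d) v x

theorem map_tensHom_id_left (L : LinMod K (Tens K C D)) {c : C} {d : D}
    (x : L.obj.obj ⟨c, d⟩) :
    (L.obj.map (tensHom K (X := ⟨c, d⟩) (Y := ⟨c, d⟩) (𝟙 c) (𝟙 d))).hom x = x :=
  congr(($(L.obj.map_id ⟨c, d⟩)).hom x)

theorem boxLeftι_map_id (d : D) {Q Q' : Tens K Eᵒᵖ C} (u : Q.fst ⟶ Q'.fst) (v : Q.snd ⟶ Q'.snd)
    (x : G.obj.obj ⟨op Q'.snd, d⟩) :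
    boxLeftι F G d Q ((G.obj.map (tensHom K (X := ⟨op Q'.snd, d⟩) (Y := ⟨op Q.snd, d⟩)
      v.op (𝟙 d))).hom x) ≫ (boxLeft F G).obj.map
        (tensHom K (X := ⟨d, Q.fst⟩) (Y := ⟨d, Q'.fst⟩) (𝟙 d) u) =
      F.obj.map (tensHom K u v) ≫ boxLeftι F G d Q' x := by
  rw [boxLeftι_map, map_tensHom_id_left]
  refine (congrArg (F.obj.map (tensHom K (X := Q) (Y := ⟨Q'.fst, Q.snd⟩) u (𝟙 Q.snd)) ≫ ·)
    (boxLeftι_nat F G d Q'.fst v x)).trans ?_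
  refine (Category.assoc _ _ _).symm.trans (congrArg (· ≫ boxLeftι F G d Q' x) ?_)
  refine (F.obj.map_comp _ _).symm.trans (congrArg F.obj.map ?_)
  exact (tensHom_comp K (X := Q) (Y := ⟨Q'.fst, Q.snd⟩) (Z := Q') _ _ _ _).trans
    (congrArg₂ (tensHom K (X := Q) (Y := Q')) (Category.comp_id u) (Category.id_comp v))

/-- `x ↦ boxLeftι x` as a linear map. -/
noncomputable def boxLeftιLin (d : D) (Q : Tens K Eᵒᵖ C) : G.obj.obj ⟨op Q.snd, d⟩ →ₗ[K]
    (F.obj.obj Q ⟶ (boxLeft F G).obj.obj ⟨d, Q.fst⟩) where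
  toFun := boxLeftι F G d Q
  map_add' := curryι_add F (N := (curry G).obj.obj d) Q.fst
  map_smul' := curryι_smul F (N := (curry G).obj.obj d) Q.fst

/-- The morphism `L(d, e) ⟶ L ⊗ H` attached to `h ∈ H(d, e)`, as a linear map. -/
noncomputable def resTensι (L : LinFun K (Tens K D Eᵒᵖ) A) (P : Tens K D Eᵒᵖ) :
    H.obj.obj ⟨op P.fst, P.snd.unop⟩ →ₗ[K] (L.obj.obj P ⟶ tensObj L (resOp.obj H)) where
  toFun h := tensι L (G := resOp.obj H) (c := P) h
  map_add' := tensι_add L (G := resOp.obj H) (c := P)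
  map_smul' := tensι_smul L (G := resOp.obj H) (c := P)

theorem resTensι_nat (L : LinFun K (Tens K D Eᵒᵖ) A) {P Q : Tens K D Eᵒᵖ} (f : P.fst ⟶ Q.fst)
    (u : P.snd ⟶ Q.snd) (h : H.obj.obj ⟨op Q.fst, Q.snd.unop⟩) :
    resTensι H L P ((H.obj.map (tensHom K (X := ⟨op Q.fst, Q.snd.unop⟩)
      (Y := ⟨op P.fst, P.snd.unop⟩) f.op u.unop)).hom h) =
      L.obj.map (tensHom K f u) ≫ resTensι H L Q h :=
  tensι_nat L (G := resOp.obj H) (tensHom K f u) h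

/-- The universal family of `(F ⊠_C G) ⊗ H`. -/
noncomputable def balancedLeft :
    Balanced F G H (tensObj (boxLeft F G) (resOp.obj H)) where
  app d Q := (Linear.comp _ _ _).compl₁₂ (boxLeftιLin F G d Q)
    (resTensι H (boxLeft F G) ⟨d, Q.fst⟩)
  nat d {Q Q'} u v x h := by
    refine (congrArg (boxLeftι F G d Q ((G.obj.map (tensHom K (X := ⟨op Q'.snd, d⟩)
      (Y := ⟨op Q.snd, d⟩) v.op (𝟙 d))).hom x) ≫ ·) (resTensι_nat H (boxLeft F G)
        (P := ⟨d, Q.fst⟩) (Q := ⟨d, Q'.fst⟩) (𝟙 d) u h)).trans ?_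
    refine (Category.assoc _ _ _).symm.trans ((congrArg
      (· ≫ resTensι H (boxLeft F G) ⟨d, Q'.fst⟩ h) (boxLeftι_map_id F G d u v x)).trans ?_)
    exact Category.assoc _ _ _
  bal {d d'} Q f x h := by
    refine (congrArg (boxLeftι F G d Q x ≫ ·) (resTensι_nat H (boxLeft F G)
        (P := ⟨d, Q.fst⟩) (Q := ⟨d', Q.fst⟩) f (𝟙 Q.fst) h)).trans ?_
    refine (Category.assoc _ _ _).symm.trans (congrArg
      (· ≫ resTensι H (boxLeft F G) ⟨d', Q.fst⟩ h) ?_)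
    refine (boxLeftι_map F G Q f (𝟙 Q.fst) x).trans ?_
    exact (congrArg (· ≫ boxLeftι F G d' Q ((G.obj.map (tensHom K (X := ⟨op Q.snd, d⟩)
      (Y := ⟨op Q.snd, d'⟩) (𝟙 (op Q.snd)) f)).hom x)) (F.obj.map_id Q)).trans
        (Category.id_comp _)

/-- The universal family of `F ⊗ (G ⊠_D H)`. -/
noncomputable def balancedRight :
    Balanced F G H (tensObj F ((boxOp G).obj H)) where
  app d Q := LinearMap.mk₂ K
    (fun x h => tensι F (c := Q) ((boxι G H Q h).hom x))
    (fun x x' h => (congrArg (tensι F) (map_add _ x x')).trans (tensι_add _ _ _))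
    (fun r x h => (congrArg (tensι F) (map_smul _ r x)).trans (tensι_smul _ _ _))
    (fun x h h' => (congrArg (tensι F)
      congr(($((boxιLin G H Q d).map_add h h')).hom x)).trans (tensι_add _ _ _))
    (fun r x h => (congrArg (tensι F)
      congr(($((boxιLin G H Q d).map_smul r h)).hom x)).trans (tensι_smul _ _ _))
  nat d {Q Q'} u v x h := by
    refine Eq.trans ?_ (tensι_nat F (tensHom K u v) ((boxι G H Q' h).hom x))
    exact congrArg (tensι F) congr(($(boxι_map G H (P := Q') (Q := Q) u v h)).hom x).symm
  bal {d d'} Q f x h := congrArg (tensι F) congr(($(boxι_nat G H Q f h)).hom x)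

variable {F G H}

theorem boxLeft_hom_ext {P : Tens K D Eᵒᵖ} {f g : (boxLeft F G).obj.obj P ⟶ Z}
    (h : ∀ (c : C) (x : G.obj.obj ⟨op c, P.fst⟩),
      boxLeftι F G P.fst ⟨P.snd, c⟩ x ≫ f = boxLeftι F G P.fst ⟨P.snd, c⟩ x ≫ g) : f = g :=
  curryTens_hom_ext (F := F) (N := (curry G).obj.obj P.fst) h

/-- For fixed `h` the family is compatible with `C`, hence factors through the value of F ⊠_C G;
uniqueness of the factorization makes it linear in `h`. -/
theorem exists_boxLeft_desc (β : Balanced F G H Z) (P : Tens K D Eᵒᵖ) :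
    ∃ m : H.obj.obj ⟨op P.fst, P.snd.unop⟩ →ₗ[K] ((boxLeft F G).obj.obj P ⟶ Z),
      ∀ h c x, boxLeftι F G P.fst ⟨P.snd, c⟩ x ≫ m h = β.app P.fst ⟨P.snd, c⟩ x h := by
  have key (h : H.obj.obj ⟨op P.fst, P.snd.unop⟩) : ∃ m : (boxLeft F G).obj.obj P ⟶ Z,
      ∀ c x, boxLeftι F G P.fst ⟨P.snd, c⟩ x ≫ m = β.app P.fst ⟨P.snd, c⟩ x h := by
    refine exists_curryTensDesc (F := F) (N := (curry G).obj.obj P.fst) (a := P.snd)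
      (fun c x => β.app P.fst ⟨P.snd, c⟩ x h)
      (fun c y y' => (β.app P.fst ⟨P.snd, c⟩).map_add₂ y y' h)
      (fun c r y => (β.app P.fst ⟨P.snd, c⟩).map_smul₂ r y h) fun c c' f x => ?_
    refine Eq.trans ?_ (β.nat P.fst (Q := ⟨P.snd, c⟩) (Q' := ⟨P.snd, c'⟩) (𝟙 P.snd) f x h)
    exact congrArg (β.app P.fst ⟨P.snd, c⟩ _) (map_tensHom_id_left H h).symm
  choose m hm using key
  refine ⟨⟨⟨m, fun h h' => boxLeft_hom_ext fun c x => ?_⟩,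
    fun r h => boxLeft_hom_ext fun c x => ?_⟩, hm⟩
  · rw [hm, Preadditive.comp_add, hm, hm, map_add]
  · rw [hm, map_smul]
    exact (congrArg (r • ·) (hm h c x)).symm.trans (Linear.comp_smul _ _ _ _ _ _).symm

/-- Factor first through the values of F ⊠_C G, then over D ⊗_K Eᵒᵖ. The naturality required in the
second step combines `nat` for the variable in `E` with `bal` for the variable in `D`. -/
theorem exists_balancedLeft_desc (β : Balanced F G H Z) :
    ∃ κ : tensObj (boxLeft F G) (resOp.obj H) ⟶ Z,
      ∀ d Q x h, (balancedLeft F G H).app d Q x h ≫ κ = β.app d Q x h := by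
  choose m hm using exists_boxLeft_desc β
  have hnat (P Q : Tens K D Eᵒᵖ) (f : P.fst ⟶ Q.fst) (u : P.snd ⟶ Q.snd)
      (h : H.obj.obj ⟨op Q.fst, Q.snd.unop⟩) :
      m P ((H.obj.map (tensHom K (X := ⟨op Q.fst, Q.snd.unop⟩)
        (Y := ⟨op P.fst, P.snd.unop⟩) f.op u.unop)).hom h) =
        (boxLeft F G).obj.map (tensHom K f u) ≫ m Q h := by
    refine boxLeft_hom_ext fun c x => (hm _ _ _ _).trans ?_
    refine Eq.symm ((Category.assoc _ _ _).symm.trans ((congrArg (· ≫ m Q h)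
      (boxLeftι_map F G ⟨P.snd, c⟩ f u x)).trans ?_))
    refine (Category.assoc _ _ _).trans ((congrArg (F.obj.map _ ≫ ·) (hm Q h c _)).trans ?_)
    refine (β.nat Q.fst (Q := ⟨P.snd, c⟩) (Q' := ⟨Q.snd, c⟩) u (𝟙 c) _ h).symm.trans ?_
    refine (congrArg (fun y => β.app Q.fst ⟨P.snd, c⟩ y _) (map_tensHom_id_left G _)).trans ?_
    refine (β.bal ⟨P.snd, c⟩ f x _).symm.trans (congrArg (β.app P.fst ⟨P.snd, c⟩ x) ?_)
    refine congr(($((H.obj.map_comp _ _).symm)).hom h).trans ?_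
    exact congr((H.obj.map $((tensHom_comp K (X := ⟨op Q.fst, Q.snd.unop⟩)
      (Y := ⟨op Q.fst, P.snd.unop⟩) (Z := ⟨op P.fst, P.snd.unop⟩) (𝟙 (op Q.fst)) u.unop f.op
      (𝟙 P.snd.unop)).trans (congrArg₂ (tensHom K (X := ⟨op Q.fst, Q.snd.unop⟩)
        (Y := ⟨op P.fst, P.snd.unop⟩)) (Category.id_comp f.op) (Category.comp_id u.unop)))).hom h)
  refine ⟨tensDesc (F := boxLeft F G) (G := resOp.obj H) (fun P h => m P h)
    (fun P => map_add (m P)) (fun P => map_smul (m P))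
    (tensDesc_nat_of_tensHom (G := resOp.obj H) m hnat), fun d Q x h => ?_⟩
  refine (Category.assoc _ _ _).trans (Eq.trans ?_ (hm ⟨d, Q.fst⟩ h Q.snd x))
  exact congrArg (boxLeftι F G d Q x ≫ ·) (tensι_desc (F := boxLeft F G) (G := resOp.obj H)
    (fun P h => m P h) _ _ _ (c := ⟨d, Q.fst⟩) h)

/-- Factor first over `D`, with the vector space Hom(F(e, c), Z) as target, and then over Eᵒᵖ ⊗_K C,
where `nat` supplies the naturality. -/
theorem exists_balancedRight_desc (β : Balanced F G H Z) :
    ∃ κ : tensObj F ((boxOp G).obj H) ⟶ Z,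
      ∀ d Q x h, (balancedRight F G H).app d Q x h ≫ κ = β.app d Q x h := by
  choose m hm using exists_boxOp_desc β
  refine ⟨tensDesc (F := F) (G := (boxOp G).obj H) (fun P h => (m P).hom h)
    (fun P => map_add (m P).hom) (fun P => map_smul (m P).hom)
    (tensDesc_nat_of_tensHom (G := (boxOp G).obj H) (fun P => (m P).hom) ?_), fun d Q x h => ?_⟩
  · intro P Q u v z
    have hl : ((boxOp G).obj H).obj.map (tensHom K u v).op ≫ m P =
        m Q ≫ ModuleCat.ofHom (Linear.leftComp K Z (F.obj.map (tensHom K u v))) := by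
      refine boxOp_hom_ext G fun d h => ?_
      refine (Category.assoc _ _ _).symm.trans
        ((congrArg (· ≫ m P) (boxι_map G H (P := Q) (Q := P) u v h)).trans ?_)
      refine ModuleCat.hom_ext (LinearMap.ext fun x => (hm P d _ _).trans ?_)
      exact (β.nat d u v x h).trans (congrArg (F.obj.map (tensHom K u v) ≫ ·) (hm Q d h x).symm)
    exact congr(($hl).hom z)
  · exact (tensι_desc (F := F) (G := (boxOp G).obj H) (fun P h => (m P).hom h) _ _ _
      (c := Q) ((boxι G H Q h).hom x)).trans (hm Q d h x)

theorem balancedLeft_hom_ext {f g : tensObj (boxLeft F G) (resOp.obj H) ⟶ Z}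
    (hfg : ∀ d Q x h, (balancedLeft F G H).app d Q x h ≫ f =
      (balancedLeft F G H).app d Q x h ≫ g) : f = g :=
  tens_hom_ext fun P h => boxLeft_hom_ext fun c x =>
    (Category.assoc _ _ _).symm.trans ((hfg P.fst ⟨P.snd, c⟩ x h).trans (Category.assoc _ _ _))

/-- `z ↦ tensι z ≫ f` as a linear map. -/
noncomputable def tensιComp {M : LinMod K (Tens K Eᵒᵖ C)ᵒᵖ} (f : tensObj F M ⟶ Z)
    (Q : Tens K Eᵒᵖ C) : M.obj.obj (op Q) ⟶ ModuleCat.of K (F.obj.obj Q ⟶ Z) :=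
  ModuleCat.ofHom (Linear.rightComp K _ f ∘ₗ
    { toFun := tensι F, map_add' := tensι_add F, map_smul' := tensι_smul F })

theorem balancedRight_hom_ext {f g : tensObj F ((boxOp G).obj H) ⟶ Z}
    (hfg : ∀ d Q x h, (balancedRight F G H).app d Q x h ≫ f =
      (balancedRight F G H).app d Q x h ≫ g) : f = g := by
  refine tens_hom_ext fun Q z => ?_
  have hl : tensιComp f Q = tensιComp g Q := boxOp_hom_ext G fun d h =>
    ModuleCat.hom_ext (LinearMap.ext fun x => hfg d Q x h)
  exact congr(($hl).hom z)

variable (F G)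

/-- Associativity of the tensor product. -/
theorem exists_tensAssoc_iso (H : LinMod K (Tens K Dᵒᵖ E)) :
    ∃ κ : tensObj (boxLeft F G) (resOp.obj H) ≅ tensObj F ((boxOp G).obj H),
      ∀ d Q x h, (balancedLeft F G H).app d Q x h ≫ κ.hom = (balancedRight F G H).app d Q x h := by
  obtain ⟨κ, hκ⟩ := exists_balancedLeft_desc (balancedRight F G H)
  obtain ⟨κ', hκ'⟩ := exists_balancedRight_desc (balancedLeft F G H)
  refine ⟨⟨κ, κ', ?_, ?_⟩, hκ⟩
  · refine balancedLeft_hom_ext fun d Q x h => ?_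
    rw [reassoc_of% (hκ d Q x h), hκ', Category.comp_id]
  · refine balancedRight_hom_ext fun d Q x h => ?_
    rw [reassoc_of% (hκ' d Q x h), hκ, Category.comp_id]

/-- Associativity of the tensor product, naturally in the last variable. -/
theorem nonempty_tensAssoc :
    Nonempty (resOp ⋙ tensFunctor (boxLeft F G) ≅ boxOp (E := E) G ⋙ tensFunctor F) := by
  choose κ hκ using exists_tensAssoc_iso F G
  refine ⟨NatIso.ofComponents κ fun {H H'} α => balancedLeft_hom_ext fun d Q x h => ?_⟩
  have h₁ : (balancedLeft F G H).app d Q x h ≫ tensMap (boxLeft F G) (resOp.map α) =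
      (balancedLeft F G H').app d Q x ((α.hom.app _).hom h) :=
    (Category.assoc _ _ _).trans (congrArg (boxLeftι F G d Q x ≫ ·)
      (tensι_map (boxLeft F G) (resOp.map α) (c := ⟨d, Q.fst⟩) h))
  have h₂ : (balancedRight F G H).app d Q x h ≫ tensMap F ((boxOp G).map α) =
      (balancedRight F G H').app d Q x ((α.hom.app _).hom h) :=
    (tensι_map F ((boxOp G).map α) (c := Q) _).trans
      (congrArg (tensι F) congr(($(boxι_map_app G α Q h)).hom x))
  refine (Category.assoc _ _ _).symm.trans ((congrArg (· ≫ (κ H').hom) h₁).trans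
    ((hκ H' d Q x _).trans (h₂.symm.trans ?_)))
  exact (congrArg (· ≫ tensMap F ((boxOp G).map α)) (hκ H d Q x h).symm).trans
    (Category.assoc _ _ _)

end Associativity

/-! ### Free modules and the comparison of the derived functors -/

section FreeModules

variable {K : Type u} [Field K]
  {X : Type u} [Category.{u} X] [Preadditive X] [Linear K X]
  {Y : Type u} [Category.{u} Y] [Preadditive Y] [Linear K Y]

theorem projective_precomp_sigma (P : X ⥤ Y) [P.Additive] [P.Linear K] {J : Type u}
    (M : J → LinMod K Y) (h : ∀ j, Projective ((precompFunctor P).obj (M j))) :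
    Projective ((precompFunctor P).obj (∐ M)) := by
  have := projective_sigma _ h
  exact Projective.of_iso (PreservesCoproduct.iso (precompFunctor P) M).symm inferInstance

end FreeModules

section Comparison

variable {K : Type u} [Field K]
  {C : Type u} [Category.{u} C] [Preadditive C] [Linear K C]
  {D : Type u} [Category.{u} D] [Preadditive D] [Linear K D]
  {E : Type u} [Category.{u} E] [Preadditive E] [Linear K E]
  {A : Type w} [Category.{u} A] [Abelian A] [Linear K A] [HasCoproducts.{u} A]
  {F : LinFun K (Tens K Eᵒᵖ C) A} {G : LinMod K (Tens K Cᵒᵖ D)}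

/-- `G ⊠_D P` is acyclic for a free module `P`, if the modules `G(-, d)` are acyclic. -/
theorem isLeftAcyclic_boxOp_sigma_rep [AB4OfSize.{u} A]
    (hFG : ∀ d, IsLeftAcyclic (tensFunctor (curry F)) ((curry G).obj.obj d))
    {J : Type u} (x : J → Tens K Dᵒᵖ E) :
    IsLeftAcyclic (tensFunctor F) ((boxOp G).obj (∐ fun j => rep K (x j))) := by
  have := AB4OfSize.ofShape (C := A) J
  refine IsLeftAcyclic.of_iso (IsLeftAcyclic.sigma (tensFunctor F) linMod_mono_sigmaMap
    fun j => ?_) (PreservesCoproduct.iso (boxOp G) fun j => rep K (x j)).symm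
  -- Each summand is induced from some G(-, d), which is acyclic by hypothesis.
  have := isIso_indToBoxOp G (x j).fst.unop (x j).snd
  exact (IsLeftAcyclic.ind F (x j).snd (hFG (x j).fst.unop)).of_iso
    (asIso (indToBoxOp G (x j).fst.unop (x j).snd))

/-- The comparison of derived functors, by dimension shifting along a free presentation of `H`. -/
theorem nonempty_leftDerived_iso [AB4OfSize.{u} A]
    (hFG : ∀ d, IsLeftAcyclic (tensFunctor (curry F)) ((curry G).obj.obj d)) (i : ℕ)
    (H : LinMod K (Tens K Dᵒᵖ E))
    (hGH : ∀ e, IsLeftAcyclic (tensFunctor (curry G)) ((curryAt e).obj H)) :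
    Nonempty (((tensFunctor (boxLeft F G)).leftDerived i).obj (resOp.obj H) ≅
      ((tensFunctor F).leftDerived i).obj ((boxOp G).obj H)) := by
  obtain ⟨κ⟩ := nonempty_tensAssoc (E := E) F G
  induction i using Nat.strong_induction_on generalizing H with
  | _ i ih =>
  obtain ⟨J, x, H', f, g, w, hS⟩ := exists_shortExact_rep H
  have h₁ := shortExact_map_precomp (opTensRight K D E) hS
  have h₂ := shortExact_map_boxOp G hS hGH
  have hp : Projective (resOp.obj (∐ fun j => rep K (x j))) :=
    projective_precomp_sigma _ _ fun j => projective_precomp_opTensRight_rep (x j)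
  have a₁ := isLeftAcyclic_of_projective (tensFunctor (boxLeft F G))
    (resOp.obj (∐ fun j => rep K (x j)))
  have a₂ := isLeftAcyclic_boxOp_sigma_rep hFG x
  -- The hypothesis passes to the syzygy, since a free module stays projective in the variable `D`
  -- alone.
  have hGH' (e : E) : IsLeftAcyclic (tensFunctor (curry G)) ((curryAt e).obj H') := by
    have : Projective ((curryAt e).obj (∐ fun j => rep K (x j))) :=
      projective_precomp_sigma _ _ fun j => projective_curryAt_rep (x j) e
    exact IsLeftAcyclic.X₁ (shortExact_map_precomp (insFst K e) hS)
      (isLeftAcyclic_of_projective _ ((curryAt e).obj (∐ fun j => rep K (x j)))) (hGH e)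
  match i with
  | 0 =>
    exact ⟨(tensFunctor (boxLeft F G)).leftDerivedZeroIsoSelf.app _ ≪≫ κ.app H ≪≫
      ((tensFunctor F).leftDerivedZeroIsoSelf.app _).symm⟩
  | 1 =>
    obtain ⟨e₁⟩ := nonempty_leftDerived_one_iso_kernel (tensFunctor (boxLeft F G)) h₁ a₁
    obtain ⟨e₂⟩ := nonempty_leftDerived_one_iso_kernel (tensFunctor F) h₂ a₂
    -- The only use of the naturality of `κ`: it matches the two kernels. In higher degrees the mere
    -- existence of an isomorphism for `H'` is enough.
    exact ⟨e₁ ≪≫ kernel.mapIso _ _ (κ.app H') (κ.app _) (κ.hom.naturality f) ≪≫ e₂.symm⟩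
  | i + 2 =>
    obtain ⟨e₁⟩ := nonempty_leftDerived_shift (tensFunctor (boxLeft F G)) h₁ a₁ i.succ_pos
    obtain ⟨e₂⟩ := nonempty_leftDerived_shift (tensFunctor F) h₂ a₂ i.succ_pos
    obtain ⟨e⟩ := ih (i + 1) (Nat.lt_succ_self _) H' hGH'
    exact ⟨e₁ ≪≫ e ≪≫ e₂.symm⟩

end Comparison

end KCat

theorem proposition3p7 {K : Type u} [Field K]
    {C : Type u} [Category.{u} C] [Preadditive C] [Linear K C]
    {D : Type u} [Category.{u} D] [Preadditive D] [Linear K D]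
    {E : Type u} [Category.{u} E] [Preadditive E] [Linear K E]
    {A : Type w} [Category.{u} A] [Abelian A] [Linear K A]
    [HasCoproducts.{u} A] [AB4OfSize.{u} A]
    (F : KCat.LinFun K (KCat.Tens K Eᵒᵖ C) A)
    (G : KCat.LinFun K (KCat.Tens K Cᵒᵖ D) (ModuleCat.{u} K))
    (H : KCat.LinFun K (KCat.Tens K Dᵒᵖ E) (ModuleCat.{u} K))
    (hFG : ∀ (d : D) (n : ℕ), 0 < n →
      IsZero (KCat.Tor n (KCat.curry F) ((KCat.curry G).obj.obj d)))
    (hGH : ∀ (e : E) (n : ℕ), 0 < n →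
      IsZero (KCat.Tor n (KCat.curry G) ((KCat.curry H).obj.obj e)))
    (i : ℕ) :
    Nonempty
      (KCat.Tor i (KCat.uncurry (KCat.box (KCat.curry F) G))
          (KCat.precomp (KCat.opTensRight K D E) H) ≅
        KCat.Tor i F
          (KCat.precomp (KCat.opTensLeft K E C)
            (KCat.uncurry (KCat.box (KCat.curry G) H)))) :=
  -- The hypotheses on `Tor` unfold to acyclicity, and the two transported modules to `resOp.obj H`
  -- and `(boxOp G).obj H`.
  KCat.nonempty_leftDerived_iso hFG i H hGH
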